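/- A $d$-dimensional VASS-MDP ($d\in\mathbb N$) is a tuple $S=(Q,Q_1,Q_P,T,\tau)$, where $Q$ is a finite set of control states partitioned into $Q_1$ (Player 1) and $Q_P$ (the probabilistic player), $T\subseteq Q\times\mathbb Z^d\times Q$ is a finite set of transitions, and $\tau:T\to\mathbb N\setminus\{0\}$ assigns weights. Configurations are pairs $(q,v)\in Q\times\mathbb N^d$. A transition $(q,z,q')\in T$ is enabled at $(q,v)$ if $v+z\ge 0$ componentwise, and then leads to $(q',v+z)$. A configuration without enabled transitions is a deadlock; deadlocks are allowed. $S$ is a 1-VASS-MDP if $z=0$ for all $(q,z,q')\in T$ with $q\in Q_P$. $S$ induces an MDP $M_S$ on its configurations. In a non-deadlock configuration of Player 1, a strategy $\sigma$ (a function of the finite history of configurations) chooses a successor configuration; in a non-deadlock configuration $c$ with control state in $Q_P$, the next configuration is $c'$ with probability $\sum\{\tau(t): t \text{ enabled at } c,\ t \text{ leads from } c \text{ to } c'\}\,/\,\sum\{\tau(t): t \text{ enabled at } c\}$; a play stops in a deadlock. Let $\mathbb P(M_S,c_0,\sigma,\Diamond X)$ be the probability that the play from $c_0$ under $\sigma$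 visits a configuration whose control state lies in $X\subseteq Q$. **Theorem.** The limit-sure reachability problem for 1-VASS-MDPs is decidable: there is an algorithm that, given a 1-VASS-MDP $S$ of any dimension $d\ge 0$, an initial configuration $c_0$ and a set $X\subseteq Q$ of target states, decides whether $$\sup_{\sigma}\ \mathbb P(M_S,c_0,\sigma,\Diamond X)=1,$$ that is, whether for every $\varepsilon>0$ there is a strategy $\sigma$ of Player 1 with $\mathbb P(M_S,c_0,\sigma,\Diamond X)\ge 1-\varepsilon$. -/

import Mathlib

open MeasureTheory ProbabilityTheory
open scoped ENNReal

noncomputable section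

/-- A Markov decision process on a set `C` of configurations. The configurations in `C₁` belong to
Player 1, all others to the probabilistic player. `step` is the transition relation, and `prob`
gives every probabilistic configuration that is not a deadlock a distribution on its successors. -/
structure MDP (C : Type) where
  C₁ : Set C
  step : C → C → Prop
  prob : ∀ c, c ∉ C₁ → (∃ c', step c c') → PMF C
  mem_support_prob : ∀ c h h' c', c' ∈ (prob c h h').support ↔ step c c'

namespace MDP

/-- The last configuration of the finite sequence `h 0, …, h k`. -/
def last {C : Type} {k : ℕ} (h : Finset.Iic k → C) : C := h ⟨k, Finset.mem_Iic.2 le_rfl⟩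

/-- A (deterministic, history-dependent) strategy of Player 1: it maps every finite sequence
`c₀, …, c_k` whose last configuration belongs to Player 1 and is not a deadlock to a successor of
`c_k`. Its values at other sequences play no role. -/
structure Strategy {C : Type} (M : MDP C) where
  choice : (k : ℕ) → (Finset.Iic k → C) → C
  legal : ∀ k h, last h ∈ M.C₁ → (∃ c', M.step (last h) c') → M.step (last h) (choice k h)

open Classical in
/-- The law of the next configuration after the history `h`. A maximal play that ends in a deadlock
is represented by the infinite sequence that repeats its last configuration for ever. -/
def next {C : Type} (M : MDP C) (σ : M.Strategy) (k : ℕ) (h : Finset.Iic k → C) : PMF C :=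
  if hs : ∃ c', M.step (last h) c' then
    if h₁ : last h ∈ M.C₁ then PMF.pure (σ.choice k h) else M.prob (last h) h₁ hs
  else PMF.pure (last h)

/-- `next` as a Markov kernel from histories to configurations. -/
def kernel {C : Type} [Countable C] [MeasurableSpace C] [MeasurableSingletonClass C]
    (M : MDP C) (σ : M.Strategy) (k : ℕ) : Kernel (Finset.Iic k → C) C where
  toFun h := (M.next σ k h).toMeasure
  measurable' := measurable_of_countable _

instance {C : Type} [Countable C] [MeasurableSpace C] [MeasurableSingletonClass C]
    (M : MDP C) (σ : M.Strategy) (k : ℕ) : IsMarkovKernel (M.kernel σ k) :=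
  ⟨fun h => PMF.toMeasure.isProbabilityMeasure (M.next σ k h)⟩

/-- The probability measure on plays from `c` under the strategy `σ` (Ionescu-Tulcea). -/
def playMeasure {C : Type} [Countable C] [MeasurableSpace C] [MeasurableSingletonClass C]
    (M : MDP C) (c : C) (σ : M.Strategy) : Measure (ℕ → C) :=
  Kernel.traj (X := fun _ => C) (fun k => M.kernel σ k) 0 (fun _ => c)

/-- The value `sup_σ ℙ(M, c, σ, A)` of the event `A` from `c`. -/
def value {C : Type} [Countable C] [MeasurableSpace C] [MeasurableSingletonClass C]
    (M : MDP C) (c : C) (A : Set (ℕ → C)) : ℝ≥0∞ :=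
  ⨆ σ : M.Strategy, M.playMeasure c σ A

end MDP

/-- A `d`-dimensional VASS-MDP with control states `0, …, n - 1`. The states in `Q₁` belong to
Player 1 and all others to the probabilistic player; `T` is the finite set of transitions
`(x, z, y)`, from `x` to `y` with counter effect `z`. The weight function is a map from `T` to the
positive integers; it is extended by `0` outside `T`. -/
structure VASSMDP (d n : ℕ) where
  Q₁ : Finset (Fin n)
  T : Finset (Fin n × (Fin d → ℤ) × Fin n)
  τ : Fin n × (Fin d → ℤ) × Fin n → ℕ
  τ_pos_iff : ∀ t, 0 < τ t ↔ t ∈ T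

namespace VASSMDP

/-- A control state together with a vector of natural counter values. -/
abbrev Config (d n : ℕ) : Type := Fin n × (Fin d → ℕ)

/-- The transitions of `S` that are enabled at `c`: they start in the control state of `c` and do
not make a counter negative. -/
def enabled {d n : ℕ} (S : VASSMDP d n) (c : Config d n) : Finset (Fin n × (Fin d → ℤ) × Fin n) :=
  {t ∈ S.T | t.1 = c.1 ∧ ∀ i, 0 ≤ (c.2 i : ℤ) + t.2.1 i}

/-- The result of firing a transition (only used for transitions enabled at `c`). -/
def fire {d n : ℕ} (t : Fin n × (Fin d → ℤ) × Fin n) (c : Config d n) : Config d n :=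
  (t.2.2, fun i => ((c.2 i : ℤ) + t.2.1 i).toNat)

/-- The total weight of the enabled transitions leading from `c` to `c'`. -/
def weight {d n : ℕ} (S : VASSMDP d n) (c c' : Config d n) : ℝ≥0∞ :=
  ∑ t ∈ S.enabled c with fire t c = c', (S.τ t : ℝ≥0∞)

theorem weight_ne_zero {d n : ℕ} (S : VASSMDP d n) (c c' : Config d n) :
    S.weight c c' ≠ 0 ↔ ∃ t ∈ S.enabled c, fire t c = c' := by
  simp only [weight, ne_eq, Finset.sum_eq_zero_iff, Finset.mem_filter, Nat.cast_eq_zero,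
    not_forall]
  constructor
  · rintro ⟨t, ht, -⟩
    exact ⟨t, ht⟩
  · rintro ⟨t, ht, h⟩
    exact ⟨t, ⟨ht, h⟩, ((S.τ_pos_iff t).2 (Finset.mem_filter.1 ht).1).ne'⟩

theorem tsum_weight {d n : ℕ} (S : VASSMDP d n) (c : Config d n) :
    ∑' c', S.weight c c' = ∑ t ∈ S.enabled c, (S.τ t : ℝ≥0∞) := by
  classical
  rw [tsum_eq_sum (s := (S.enabled c).image (fun t => fire t c))]
  · exact Finset.sum_fiberwise_of_maps_to (fun t ht => Finset.mem_image_of_mem _ ht) _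
  · intro c' hc'
    by_contra h
    obtain ⟨t, ht, rfl⟩ := (S.weight_ne_zero c c').1 h
    exact hc' (Finset.mem_image_of_mem _ ht)

/-- The MDP induced by `S`. From a probabilistic configuration, an enabled transition is taken with
probability proportional to its weight. -/
def toMDP {d n : ℕ} (S : VASSMDP d n) : MDP (Config d n) where
  C₁ := {c | c.1 ∈ S.Q₁}
  step c c' := ∃ t ∈ S.enabled c, fire t c = c'
  prob c _ h := PMF.normalize (S.weight c)
    (by
      obtain ⟨c', hc'⟩ := h
      exact fun h0 => (S.weight_ne_zero c c').2 hc' (ENNReal.tsum_eq_zero.1 h0 c'))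
    (by
      rw [tsum_weight]
      exact ENNReal.sum_ne_top.2 fun t _ => ENNReal.natCast_ne_top _)
  mem_support_prob c _ _ c' := by
    rw [PMF.mem_support_normalize_iff]
    exact S.weight_ne_zero c c'

/-- `S` is a 1-VASS-MDP: the probabilistic player never changes the counters. -/
def IsOneVASSMDP {d n : ℕ} (S : VASSMDP d n) : Prop :=
  ∀ t ∈ S.T, t.1 ∉ S.Q₁ → t.2.1 = 0

/-- The plays that visit a control state in `X`. -/
def reach {d n : ℕ} (X : Finset (Fin n)) : Set (ℕ → Config d n) :=
  {ω | ∃ k, (ω k).1 ∈ X}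

/-- Player 1 can reach `X` limit-surely from `c₀`: the supremum over all strategies of the
probability to visit `X` is `1`. -/
def LimitSureReach {d n : ℕ} (S : VASSMDP d n) (c₀ : Config d n) (X : Finset (Fin n)) : Prop :=
  S.toMDP.value c₀ (reach X) = 1

/-- Inputs of an algorithm: a dimension, one bit per control state (does it belong to Player 1?), a
list of weighted transitions, an initial configuration, and one bit per control state (is it a
target?). -/
abbrev Code : Type :=
  ℕ × List Bool × List ((ℕ × List ℤ × ℕ) × ℕ) × (ℕ × List ℕ) × List Bool

/-- `w` is a description of the VASS-MDP `S`, the initial configuration `c₀` and the target set `X`.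
The transitions are listed without repetition, in any order. -/
def Encodes {d n : ℕ} (w : Code) (S : VASSMDP d n) (c₀ : Config d n) (X : Finset (Fin n)) : Prop :=
  ∃ l : List (Fin n × (Fin d → ℤ) × Fin n), l.Nodup ∧ l.toFinset = S.T ∧
    w = (d,
      List.ofFn (fun q => decide (q ∈ S.Q₁)),
      l.map (fun t => (((t.1 : ℕ), List.ofFn t.2.1, (t.2.2 : ℕ)), S.τ t)),
      ((c₀.1 : ℕ), List.ofFn c₀.2),
      List.ofFn (fun q => decide (q ∈ X)))

end VASSMDP

end

noncomputable section

/-! ### Optimal values by backward recursion, and their monotonicity -/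

namespace VASSMDP

variable {d n : ℕ} (S : VASSMDP d n) (X : Finset (Fin n))

/-- Transitions enabled at `c` when the counters in `I` are unbounded. -/
def enabledAt (I : Finset (Fin d)) (c : Config d n) : Finset (Fin n × (Fin d → ℤ) × Fin n) :=
  {t ∈ S.T | t.1 = c.1 ∧ ∀ i ∉ I, 0 ≤ (c.2 i : ℤ) + t.2.1 i}

/-- Fire a transition, leaving the counters in `I` unchanged. -/
def fireAt (I : Finset (Fin d)) (t : Fin n × (Fin d → ℤ) × Fin n) (c : Config d n) : Config d n :=
  (t.2.2, fun i => if i ∈ I then c.2 i else ((c.2 i : ℤ) + t.2.1 i).toNat)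

/-- The optimal probability of visiting `X` within `k` steps, with the counters in `I` unbounded. -/
def stepValue (I : Finset (Fin d)) : ℕ → Config d n → ℝ
  | 0, c => if c.1 ∈ X then 1 else 0
  | k + 1, c =>
    if c.1 ∈ X then 1
    else if c.1 ∈ S.Q₁ then ⨆ t : S.enabledAt I c, stepValue I k (fireAt I t c)
    else (∑ t ∈ S.enabledAt I c, (S.τ t : ℝ) * stepValue I k (fireAt I t c)) /
      ∑ t ∈ S.enabledAt I c, (S.τ t : ℝ)

/-- The optimal probability of visiting `X`, with the counters in `I` unbounded. -/
def limValue (I : Finset (Fin d)) (c : Config d n) : ℝ := ⨆ k, S.stepValue X I k c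

variable {S X} {I J : Finset (Fin d)} {c c' : Config d n} {t : Fin n × (Fin d → ℤ) × Fin n}

theorem mem_enabledAt :
    t ∈ S.enabledAt I c ↔ t ∈ S.T ∧ t.1 = c.1 ∧ ∀ i ∉ I, 0 ≤ (c.2 i : ℤ) + t.2.1 i :=
  Finset.mem_filter

theorem enabledAt_empty : S.enabledAt ∅ c = S.enabled c := by
  simp [enabledAt, enabled]

theorem fireAt_empty : fireAt ∅ t c = fire t c := by
  simp [fireAt, fire]

theorem weight_pos (ht : t ∈ S.enabledAt I c) : 0 < (S.τ t : ℝ) :=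
  Nat.cast_pos.2 ((S.τ_pos_iff t).2 (mem_enabledAt.1 ht).1)

theorem sum_weight_pos (ht : t ∈ S.enabledAt I c) : 0 < ∑ t ∈ S.enabledAt I c, (S.τ t : ℝ) :=
  Finset.sum_pos (fun _ h => weight_pos h) ⟨t, ht⟩

theorem stepValue_of_mem (h : c.1 ∈ X) (k : ℕ) : S.stepValue X I k c = 1 := by
  cases k <;> simp [stepValue, h]

theorem stepValue_player (h : c.1 ∉ X) (h₁ : c.1 ∈ S.Q₁) (k : ℕ) :
    S.stepValue X I (k + 1) c = ⨆ t : S.enabledAt I c, S.stepValue X I k (fireAt I t c) := by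
  simp [stepValue, h, h₁]

theorem stepValue_random (h : c.1 ∉ X) (h₁ : c.1 ∉ S.Q₁) (k : ℕ) :
    S.stepValue X I (k + 1) c =
      (∑ t ∈ S.enabledAt I c, (S.τ t : ℝ) * S.stepValue X I k (fireAt I t c)) /
        ∑ t ∈ S.enabledAt I c, (S.τ t : ℝ) := by
  simp [stepValue, h, h₁]

theorem average_le {f : Fin n × (Fin d → ℤ) × Fin n → ℝ} {b : ℝ} (hb : 0 ≤ b)
    (h : ∀ t ∈ S.enabledAt I c, f t ≤ b) :
    (∑ t ∈ S.enabledAt I c, (S.τ t : ℝ) * f t) / ∑ t ∈ S.enabledAt I c, (S.τ t : ℝ) ≤ b := by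
  refine div_le_of_le_mul₀ (Finset.sum_nonneg fun _ _ => Nat.cast_nonneg _) hb ?_
  rw [Finset.mul_sum]
  refine Finset.sum_le_sum fun t ht => ?_
  rw [mul_comm]
  exact mul_le_mul_of_nonneg_right (h t ht) (Nat.cast_nonneg _)

theorem stepValue_nonneg (k : ℕ) (c : Config d n) : 0 ≤ S.stepValue X I k c := by
  induction k generalizing c with
  | zero => simp only [stepValue]; split_ifs <;> norm_num
  | succ k ih =>
    simp only [stepValue]
    split_ifs
    · norm_num
    · exact Real.iSup_nonneg fun t => ih _
    · exact div_nonneg (Finset.sum_nonneg fun t _ => mul_nonneg (Nat.cast_nonneg _) (ih _))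
        (Finset.sum_nonneg fun t _ => Nat.cast_nonneg _)

theorem stepValue_le_of_forall {b : ℝ} (hb : 0 ≤ b) (hX : c.1 ∉ X) {k : ℕ}
    (h : ∀ t ∈ S.enabledAt I c, S.stepValue X I k (fireAt I t c) ≤ b) :
    S.stepValue X I (k + 1) c ≤ b := by
  by_cases h₁ : c.1 ∈ S.Q₁
  · rw [stepValue_player hX h₁]
    exact Real.iSup_le (fun t => h t t.2) hb
  · rw [stepValue_random hX h₁]
    exact average_le hb h

theorem stepValue_le_one (k : ℕ) (c : Config d n) : S.stepValue X I k c ≤ 1 := by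
  by_cases hX : c.1 ∈ X
  · rw [stepValue_of_mem hX]
  induction k generalizing c with
  | zero => simp [stepValue, hX]
  | succ k ih =>
    refine stepValue_le_of_forall zero_le_one hX fun t _ => ?_
    by_cases hX' : (fireAt I t c).1 ∈ X
    · rw [stepValue_of_mem hX']
    · exact ih _ hX'

/-- The enabled transitions of a probabilistic state of a 1-VASS-MDP depend on the state only. -/
theorem IsOneVASSMDP.enabledAt_eq (hS : S.IsOneVASSMDP) (h : c.1 = c'.1) (h₁ : c.1 ∉ S.Q₁) :
    S.enabledAt I c = S.enabledAt J c' := by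
  ext t
  simp only [mem_enabledAt, h]
  refine and_congr_right fun ht => and_congr_right fun h' => ?_
  have := hS t ht (by rwa [h', ← h])
  simp [this]

/-- A bound for the amounts by which transitions decrease counters. -/
def decrBound (S : VASSMDP d n) : ℕ := ∑ t ∈ S.T, ∑ i, (t.2.1 i).natAbs

theorem neg_le_decrBound (ht : t ∈ S.T) (i : Fin d) : -t.2.1 i ≤ S.decrBound := by
  have h1 : (t.2.1 i).natAbs ≤ ∑ i, (t.2.1 i).natAbs :=
    Finset.single_le_sum (f := fun i => (t.2.1 i).natAbs) (fun _ _ => Nat.zero_le _)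
      (Finset.mem_univ i)
  have h2 : ∑ i, (t.2.1 i).natAbs ≤ S.decrBound :=
    Finset.single_le_sum (f := fun t : Fin n × (Fin d → ℤ) × Fin n => ∑ i, (t.2.1 i).natAbs)
      (fun _ _ => Nat.zero_le _) ht
  omega

/-- In `k` steps a counter drops by at most `k * S.decrBound`, so a counter that large blocks
nothing and serves as well as an unbounded one. Player 1 copies moves, and random choices agree by
`IsOneVASSMDP.enabledAt_eq`. Taking `I ⊆ J` gives monotonicity; taking `I` larger than `J` replaces
unbounded counters by large ones. -/
theorem stepValue_le_stepValue (hS : S.IsOneVASSMDP) (k : ℕ) (h : c.1 = c'.1)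
    (hle : ∀ i ∉ J, (i ∉ I → c.2 i ≤ c'.2 i) ∧ (i ∈ I → k * S.decrBound ≤ c'.2 i)) :
    S.stepValue X I k c ≤ S.stepValue X J k c' := by
  induction k generalizing c c' with
  | zero => simp [stepValue, h]
  | succ k ih =>
    by_cases hX : c.1 ∈ X
    · rw [stepValue_of_mem hX, stepValue_of_mem (h ▸ hX)]
    have key : ∀ t ∈ S.enabledAt I c, t ∈ S.enabledAt J c' ∧
        S.stepValue X I k (fireAt I t c) ≤ S.stepValue X J k (fireAt J t c') := by
      intro t ht
      obtain ⟨htT, ht1, hen⟩ := mem_enabledAt.1 ht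
      have hb : ∀ i, -t.2.1 i ≤ S.decrBound := neg_le_decrBound htT
      refine ⟨mem_enabledAt.2 ⟨htT, ht1.trans h, fun i hi => ?_⟩, ih rfl fun i hi => ⟨?_, ?_⟩⟩
      · by_cases hI : i ∈ I
        · have h1 := (hle i hi).2 hI
          have h2 := hb i
          have h3 : S.decrBound ≤ (k + 1) * S.decrBound := Nat.le_mul_of_pos_left _ (Nat.succ_pos _)
          omega
        · have h1 := (hle i hi).1 hI
          have h2 := hen i hI
          omega
      · intro hI
        have h1 := (hle i hi).1 hI
        simp only [fireAt, hI, hi, if_false]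
        exact Int.toNat_le_toNat (by omega)
      · intro hI
        have h1 := (hle i hi).2 hI
        have h2 := hb i
        rw [add_one_mul] at h1
        simp only [fireAt, hi, if_false]
        omega
    by_cases h₁ : c.1 ∈ S.Q₁
    · rw [stepValue_player hX h₁, stepValue_player (h ▸ hX) (h ▸ h₁)]
      refine Real.iSup_le (fun t => ?_) (Real.iSup_nonneg fun t => stepValue_nonneg _ _)
      exact (key t t.2).2.trans (le_ciSup (f := fun t : S.enabledAt J c' =>
        S.stepValue X J k (fireAt J t c')) (Set.finite_range _).bddAbove ⟨t, (key t t.2).1⟩)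
    · rw [stepValue_random hX h₁, stepValue_random (h ▸ hX) (h ▸ h₁),
        ← hS.enabledAt_eq (I := I) h h₁]
      refine div_le_div_of_nonneg_right (Finset.sum_le_sum fun t ht => ?_)
        (Finset.sum_nonneg fun t _ => Nat.cast_nonneg _)
      exact mul_le_mul_of_nonneg_left (key t ht).2 (Nat.cast_nonneg _)

theorem stepValue_mono (c : Config d n) : Monotone fun k => S.stepValue X I k c := by
  refine monotone_nat_of_le_succ fun k => ?_
  by_cases hX : c.1 ∈ X
  · simp [stepValue_of_mem hX]
  induction k generalizing c with
  | zero => simpa [stepValue, hX] using stepValue_nonneg (S := S) (X := X) (I := I) 1 c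
  | succ k ih =>
    have key : ∀ t, S.stepValue X I k (fireAt I t c) ≤ S.stepValue X I (k + 1) (fireAt I t c) := by
      intro t
      by_cases hX' : (fireAt I t c).1 ∈ X
      · simp [stepValue_of_mem hX']
      · exact ih _ hX'
    by_cases h₁ : c.1 ∈ S.Q₁
    · rw [stepValue_player hX h₁, stepValue_player hX h₁]
      exact ciSup_mono (Set.finite_range _).bddAbove
        fun t => key t
    · rw [stepValue_random hX h₁, stepValue_random hX h₁]
      refine div_le_div_of_nonneg_right (Finset.sum_le_sum fun t ht => ?_)
        (Finset.sum_nonneg fun t _ => Nat.cast_nonneg _)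
      exact mul_le_mul_of_nonneg_left (key t) (Nat.cast_nonneg _)

theorem bddAbove_stepValue : BddAbove (Set.range fun k => S.stepValue X I k c) :=
  ⟨1, by rintro _ ⟨k, rfl⟩; exact stepValue_le_one k c⟩

theorem stepValue_le_limValue (k : ℕ) (c : Config d n) :
    S.stepValue X I k c ≤ S.limValue X I c :=
  le_ciSup (f := fun k => S.stepValue X I k c) bddAbove_stepValue k

theorem limValue_le {b : ℝ} (h : ∀ k, S.stepValue X I k c ≤ b) : S.limValue X I c ≤ b :=
  ciSup_le h

theorem limValue_le_one (c : Config d n) : S.limValue X I c ≤ 1 :=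
  limValue_le fun k => stepValue_le_one k c

theorem limValue_nonneg (c : Config d n) : 0 ≤ S.limValue X I c :=
  (stepValue_nonneg 0 c).trans (stepValue_le_limValue 0 c)

theorem limValue_of_mem (h : c.1 ∈ X) : S.limValue X I c = 1 :=
  (limValue_le_one c).antisymm ((stepValue_of_mem h 0).ge.trans (stepValue_le_limValue 0 c))

theorem tendsto_stepValue (c : Config d n) :
    Filter.Tendsto (fun k => S.stepValue X I k c) Filter.atTop (nhds (S.limValue X I c)) :=
  tendsto_atTop_ciSup (stepValue_mono c) bddAbove_stepValue

theorem limValue_le_limValue (hS : S.IsOneVASSMDP) (hIJ : I ⊆ J) (h : c.1 = c'.1)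
    (hle : ∀ i ∉ J, c.2 i ≤ c'.2 i) : S.limValue X I c ≤ S.limValue X J c' :=
  limValue_le fun k => (stepValue_le_stepValue hS k h fun i hi =>
    ⟨fun _ => hle i hi, fun hI => absurd (hIJ hI) hi⟩).trans (stepValue_le_limValue k c')

theorem limValue_fireAt_le (h₁ : c.1 ∈ S.Q₁) (ht : t ∈ S.enabledAt I c) :
    S.limValue X I (fireAt I t c) ≤ S.limValue X I c := by
  by_cases hX : c.1 ∈ X
  · exact (limValue_le_one _).trans (limValue_of_mem hX).ge
  refine limValue_le fun k => le_trans ?_ (stepValue_le_limValue (k + 1) c)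
  rw [stepValue_player hX h₁]
  exact le_ciSup (f := fun t : S.enabledAt I c => S.stepValue X I k (fireAt I t c))
    (Set.finite_range _).bddAbove ⟨t, ht⟩

/-- The average is over finitely many successors, so the recursion passes to the limit. -/
theorem limValue_random (hX : c.1 ∉ X) (h₁ : c.1 ∉ S.Q₁) :
    S.limValue X I c = (∑ t ∈ S.enabledAt I c, (S.τ t : ℝ) * S.limValue X I (fireAt I t c)) /
      ∑ t ∈ S.enabledAt I c, (S.τ t : ℝ) := by
  refine tendsto_nhds_unique ((tendsto_stepValue c).comp (Filter.tendsto_add_atTop_nat 1)) ?_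
  simp only [Function.comp_def, stepValue_random hX h₁]
  exact (tendsto_finsetSum _ fun t _ => (tendsto_stepValue _).const_mul _).div_const _

/-- From a probabilistic configuration of value `1`, all successors have value `1`. -/
theorem limValue_fireAt_eq_one (hX : c.1 ∉ X) (h₁ : c.1 ∉ S.Q₁) (hc : S.limValue X I c = 1)
    (ht : t ∈ S.enabledAt I c) : S.limValue X I (fireAt I t c) = 1 := by
  refine (limValue_le_one _).antisymm (not_lt.1 fun hlt => ?_)
  rw [limValue_random hX h₁, div_eq_one_iff_eq (sum_weight_pos ht).ne'] at hc
  refine absurd hc (ne_of_lt (Finset.sum_lt_sum (fun s _ => ?_) ⟨t, ht, ?_⟩))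
  · exact mul_le_of_le_one_right (Nat.cast_nonneg _) (limValue_le_one _)
  · exact mul_lt_of_lt_one_right (weight_pos ht) hlt

/-- Convex lower bound for the value of a probabilistic configuration. -/
theorem le_limValue_random (hX : c.1 ∉ X) (h₁ : c.1 ∉ S.Q₁) (ht : t ∈ S.enabledAt I c) {m : ℝ}
    (hm : ∀ t' ∈ S.enabledAt I c, m ≤ S.limValue X I (fireAt I t' c)) :
    let q := (S.τ t : ℝ) / ∑ t ∈ S.enabledAt I c, (S.τ t : ℝ)
    q * S.limValue X I (fireAt I t c) + (1 - q) * m ≤ S.limValue X I c := by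
  classical
  intro q
  have hpos := sum_weight_pos ht
  rw [limValue_random hX h₁, le_div_iff₀ hpos]
  have hq : q * ∑ t ∈ S.enabledAt I c, (S.τ t : ℝ) = S.τ t := div_mul_cancel₀ _ hpos.ne'
  have h1 := Finset.add_sum_erase _ (fun t => (S.τ t : ℝ)) ht
  have h2 := Finset.add_sum_erase _ (fun t => (S.τ t : ℝ) * S.limValue X I (fireAt I t c)) ht
  have h3 : (∑ t ∈ (S.enabledAt I c).erase t, (S.τ t : ℝ)) * m ≤
      ∑ t ∈ (S.enabledAt I c).erase t, (S.τ t : ℝ) * S.limValue X I (fireAt I t c) := by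
    rw [Finset.sum_mul]
    exact Finset.sum_le_sum fun s hs =>
      mul_le_mul_of_nonneg_left (hm s (Finset.mem_of_mem_erase hs)) (Nat.cast_nonneg _)
  rw [← h2]
  calc _ = (q * ∑ t ∈ S.enabledAt I c, (S.τ t : ℝ)) * S.limValue X I (fireAt I t c) +
        ((∑ t ∈ S.enabledAt I c, (S.τ t : ℝ)) - q * ∑ t ∈ S.enabledAt I c, (S.τ t : ℝ)) * m := by
        ring
    _ ≤ _ := by
        rw [hq]
        have : (∑ t ∈ S.enabledAt I c, (S.τ t : ℝ)) - S.τ t =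
          ∑ t ∈ (S.enabledAt I c).erase t, (S.τ t : ℝ) := by linarith
        rw [this]
        linarith

end VASSMDP

/-! ### The finite game characterising value one -/

namespace VASSMDP

variable {d n : ℕ} {S : VASSMDP d n} {X : Finset (Fin n)} {I : Finset (Fin d)}

/-- Equal control states, and comparison of the counters outside `I`. -/
def leAt (I : Finset (Fin d)) (c c' : Config d n) : Prop := c.1 = c'.1 ∧ ∀ i ∉ I, c.2 i ≤ c'.2 i

/-- The counters outside `I` that are larger in `c'` than in `c`. -/
def pumped (I : Finset (Fin d)) (c c' : Config d n) : Finset (Fin d) :=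
  {i | i ∉ I ∧ c.2 i < c'.2 i}

theorem mem_pumped {c c' : Config d n} {i : Fin d} :
    i ∈ pumped I c c' ↔ i ∉ I ∧ c.2 i < c'.2 i := by
  simp [pumped]

theorem leAt.symm {a b : Config d n} (h : leAt I a b) (h' : ¬ (pumped I a b).Nonempty) :
    leAt I b a := by
  refine ⟨h.1.symm, fun i hi => not_lt.1 fun hlt => h' ⟨i, mem_pumped.2 ⟨hi, hlt⟩⟩⟩

theorem leAt.stepValue_le (hS : S.IsOneVASSMDP) {a b : Config d n} (h : leAt I a b) (k : ℕ) :
    S.stepValue X I k a ≤ S.stepValue X I k b :=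
  stepValue_le_stepValue hS k h.1 fun i hi => ⟨fun _ => h.2 i hi, fun h' => absurd h' hi⟩

theorem leAt.limValue_le (hS : S.IsOneVASSMDP) {a b : Config d n} (h : leAt I a b) :
    S.limValue X I a ≤ S.limValue X I b :=
  limValue_le_limValue hS subset_rfl h.1 h.2

variable (S X) in
/-- The winning positions of Player 1 in a finite game. The game is played on phases: `P` lists the
earlier configurations of the current phase, `c` is the current configuration, and `H` lists the
first configurations of all phases, the current one first. In a probabilistic configuration, the
opponent may start a new phase at a successor of his choice. A phase that increases counters allows
Player 1 to continue with these counters unbounded. -/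
inductive Win : Finset (Fin d) → List (Config d n) → List (Config d n) → Config d n → Prop
  | target {I H P c} : c.1 ∈ X → Win I H P c
  | pump {I H P c k} : k ∈ P → leAt I k c → (pumped I k c).Nonempty →
      Win (I ∪ pumped I k c) [k] [] k → Win I H P c
  | step {I H P c t} : (∀ k ∈ P, ¬ leAt I k c) → t ∈ S.enabledAt I c →
      (c.1 ∉ S.Q₁ → ∀ t' ∈ S.enabledAt I c, (∀ h ∈ H, ¬ leAt I h (fireAt I t' c)) →
        Win I (fireAt I t' c :: H) [] (fireAt I t' c)) →
      Win I H (c :: P) (fireAt I t c) → Win I H P c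

/-! ### Soundness -/

/-- Add `x` to the counters. -/
def shift (c : Config d n) (x : Fin d → ℕ) : Config d n := (c.1, c.2 + x)

@[simp] theorem shift_zero (c : Config d n) : shift c 0 = c := by simp [shift]

theorem shift_shift (c : Config d n) (x y : Fin d → ℕ) :
    shift (shift c x) y = shift c (x + y) := by simp [shift, add_assoc]

theorem mem_enabledAt_shift {c : Config d n} {t} (ht : t ∈ S.enabledAt I c) (x : Fin d → ℕ) :
    t ∈ S.enabledAt I (shift c x) := by
  rw [mem_enabledAt] at ht ⊢
  refine ⟨ht.1, ht.2.1, fun i hi => ?_⟩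
  have := ht.2.2 i hi
  simp only [shift, Pi.add_apply, Nat.cast_add]
  omega

theorem fireAt_shift {c : Config d n} {t} (ht : t ∈ S.enabledAt I c) (x : Fin d → ℕ) :
    fireAt I t (shift c x) = shift (fireAt I t c) x := by
  refine Prod.ext rfl (funext fun i => ?_)
  simp only [fireAt, shift, Pi.add_apply]
  split_ifs with hi
  · rfl
  · have := (mem_enabledAt.1 ht).2.2 i hi
    omega

theorem leAt_shift (c : Config d n) (x : Fin d → ℕ) : leAt I c (shift c x) :=
  ⟨rfl, fun _ _ => Nat.le_add_right _ _⟩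

variable (S X I) in
/-- With positive probability `b` is reached from `a`, otherwise a configuration of value at least
`m`; and the same holds with larger counters. -/
def Leads (m : ℝ) (a b : Config d n) : Prop :=
  ∃ q : ℝ, 0 < q ∧ q ≤ 1 ∧ ∀ x,
    q * S.limValue X I (shift b x) + (1 - q) * m ≤ S.limValue X I (shift a x)

theorem Leads.of_le (hS : S.IsOneVASSMDP) {m : ℝ} {a b : Config d n} (h : leAt I b a) :
    Leads S X I m a b := by
  refine ⟨1, one_pos, le_rfl, fun x => ?_⟩
  have : leAt I (shift b x) (shift a x) := ⟨h.1, fun i hi => Nat.add_le_add_right (h.2 i hi) _⟩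
  simpa using this.limValue_le hS

/-- The probabilities multiply: failing on either leg still leaves value at least `m`. -/
theorem Leads.trans {m : ℝ} {a b c : Config d n} (h : Leads S X I m a b) (h' : Leads S X I m b c) :
    Leads S X I m a c := by
  obtain ⟨q, hq, hq1, hab⟩ := h
  obtain ⟨r, hr, hr1, hbc⟩ := h'
  refine ⟨q * r, mul_pos hq hr, mul_le_one₀ hq1 hr.le hr1, fun x => ?_⟩
  have := mul_le_mul_of_nonneg_left (hbc x) hq.le
  linarith [hab x]

theorem Leads.shift {m : ℝ} {a b : Config d n} (h : Leads S X I m a b) (y : Fin d → ℕ) :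
    Leads S X I m (shift a y) (shift b y) := by
  obtain ⟨q, hq, hq1, hab⟩ := h
  exact ⟨q, hq, hq1, fun x => by simpa only [shift_shift] using hab (y + x)⟩

/-- In the random case raising the counters changes neither the enabled set nor the weights, so one
`q` serves all shifts, and the other branches stay above `m` by monotonicity. -/
theorem Leads.fireAt (hS : S.IsOneVASSMDP) {m : ℝ} {c : Config d n} {t}
    (ht : t ∈ S.enabledAt I c)
    (hm : c.1 ∉ S.Q₁ → ∀ t' ∈ S.enabledAt I c, m ≤ S.limValue X I (fireAt I t' c)) :
    Leads S X I m c (fireAt I t c) := by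
  by_cases hX : c.1 ∈ X
  · refine ⟨1, one_pos, le_rfl, fun x => ?_⟩
    rw [limValue_of_mem (c := VASSMDP.shift c x) hX]
    simpa using limValue_le_one _
  by_cases h₁ : c.1 ∈ S.Q₁
  · refine ⟨1, one_pos, le_rfl, fun x => ?_⟩
    have := limValue_fireAt_le (X := X) (c := VASSMDP.shift c x) h₁ (mem_enabledAt_shift ht x)
    simpa [← fireAt_shift ht] using this
  · have hpos := sum_weight_pos ht
    refine ⟨_, div_pos (weight_pos ht) hpos, (div_le_one hpos).2 ?_, fun x => ?_⟩
    · exact Finset.single_le_sum (f := fun t => (S.τ t : ℝ)) (fun _ _ => Nat.cast_nonneg _) ht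
    · have he : S.enabledAt I (VASSMDP.shift c x) = S.enabledAt I c := hS.enabledAt_eq rfl h₁
      have := le_limValue_random (X := X) (c := VASSMDP.shift c x) (m := m) hX h₁
        (mem_enabledAt_shift ht x) fun t' ht' => ?_
      · rw [he, fireAt_shift ht] at this
        exact this
      · rw [he] at ht'
        rw [fireAt_shift ht']
        exact (hm h₁ t' ht').trans ((leAt_shift _ _).limValue_le hS)

/-- The shift quantified inside `Leads` allows the same loop to be run again from its raised
starting point. -/
theorem Leads.iterate (hS : S.IsOneVASSMDP) {m : ℝ} {a : Config d n} {y : Fin d → ℕ}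
    (h : Leads S X I m a (VASSMDP.shift a y)) (j : ℕ) :
    Leads S X I m a (VASSMDP.shift a (j • y)) := by
  induction j with
  | zero => simpa using Leads.of_le hS ⟨rfl, fun _ _ => le_rfl⟩
  | succ j ih =>
    have := h.trans (ih.shift y)
    rwa [shift_shift, ← succ_nsmul] at this

/-- With `v` the value of `s`, the hypothesis gives `v ≥ q * (1 - ε) + (1 - q) * v`. Cancelling `q >
0` gives `v ≥ 1 - ε`, so it does no harm that `q` may tend to `0` with `ε`. -/
theorem limValue_eq_one_of_leads {s : Config d n}
    (h : ∀ ε > 0, ∃ b, Leads S X I (S.limValue X I s) s b ∧ 1 - ε ≤ S.limValue X I b) :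
    S.limValue X I s = 1 := by
  refine (limValue_le_one _).antisymm (le_of_forall_pos_le_add fun ε hε => ?_)
  obtain ⟨b, ⟨q, hq, -, hb⟩, hε⟩ := h ε hε
  have h0 := hb 0
  simp only [shift_zero] at h0
  have h1 := mul_le_mul_of_nonneg_left hε hq.le
  have : q * (1 - ε) ≤ q * S.limValue X I s := by linarith
  linarith [le_of_mul_le_mul_left this hq]

/-- If a phase increases the counters in `J`, and `k` has value `1` with these counters unbounded,
then repeating the phase leads to values arbitrarily close to `1`. -/
theorem exists_leads_of_pumped (hS : S.IsOneVASSMDP) {m : ℝ} {k c : Config d n} (h : leAt I k c)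
    (hk : Leads S X I m k c) (hJ : S.limValue X (I ∪ pumped I k c) k = 1) {ε : ℝ} (hε : 0 < ε) :
    ∃ b, Leads S X I m k b ∧ 1 - ε ≤ S.limValue X I b := by
  -- The net gain of one round of the loop; outside `I` the truncated subtraction is exact because
  -- `k` lies below `c`.
  set y : Fin d → ℕ := fun i => if i ∈ I then 0 else c.2 i - k.2 i with hy
  have hstep : Leads S X I m k (VASSMDP.shift k y) := by
    refine hk.trans (Leads.of_le hS ⟨h.1, fun i hi => ?_⟩)
    have := h.2 i hi
    simp only [VASSMDP.shift, Pi.add_apply, hy, hi, if_false]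
    omega
  obtain ⟨N, hN⟩ : ∃ N, 1 - ε < S.stepValue X (I ∪ pumped I k c) N k := by
    by_contra! hcon
    linarith [limValue_le hcon]
  -- Each round adds at least one to every pumped counter, so this many rounds make them sufficient
  -- for `N` steps.
  refine ⟨_, hstep.iterate hS (N * S.decrBound), hN.le.trans
    (le_trans ?_ (stepValue_le_limValue N _))⟩
  refine stepValue_le_stepValue hS N rfl fun i hi => ⟨fun _ => Nat.le_add_right _ _, fun hi' => ?_⟩
  obtain ⟨-, hlt⟩ := mem_pumped.1 ((Finset.mem_union.1 hi').resolve_left hi)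
  have h1 : 1 ≤ y i := by
    simp only [hy, hi, if_false]
    omega
  calc N * S.decrBound ≤ N * S.decrBound * y i := Nat.le_mul_of_pos_right _ h1
    _ ≤ _ := by simp [VASSMDP.shift]

/-- The induction is over plays in which the current phase starts at a configuration of least value
among all phase starts. Only such plays matter, since the opponent gains nothing by restarting
elsewhere. -/
theorem Win.limValue_eq_one_aux (hS : S.IsOneVASSMDP) {H P : List (Config d n)} {c : Config d n}
    (hw : Win S X I H P c) : ∀ {s : Config d n} {H₀ : List (Config d n)}, H = s :: H₀ →
    (∀ h ∈ H₀, S.limValue X I s ≤ S.limValue X I h) →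
    (∀ k ∈ P, Leads S X I (S.limValue X I s) k c) → Leads S X I (S.limValue X I s) s c →
    S.limValue X I s = 1 := by
  induction hw with
  | target hX =>
    intro s H₀ _ _ _ hs
    refine limValue_eq_one_of_leads fun ε hε => ⟨_, hs, ?_⟩
    rw [limValue_of_mem hX]
    linarith
  | @pump I H P c k hk hle hne _ ih =>
    intro s H₀ _ _ hP hs
    have hk1 := ih rfl (by simp) (by simp) (Leads.of_le hS ⟨rfl, fun _ _ => le_rfl⟩)
    refine limValue_eq_one_of_leads fun ε hε => ?_
    obtain ⟨b, hb, hbε⟩ := exists_leads_of_pumped hS hle (hP k hk) hk1 hε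
    exact ⟨b, (hs.trans (Leads.of_le hS hle)).trans hb, hbε⟩
  | @step I H P c t _ ht _ _ ihnew ih =>
    rintro s H₀ rfl hH hP hs
    have hstep : Leads S X I (S.limValue X I s) c (fireAt I t c) := by
      refine Leads.fireAt hS ht fun h₁ t' ht' => ?_
      by_cases hcov : ∃ h ∈ s :: H₀, leAt I h (fireAt I t' c)
      · obtain ⟨h, hmem, hle⟩ := hcov
        refine le_trans ?_ (hle.limValue_le hS)
        rcases List.mem_cons.1 hmem with rfl | hmem
        exacts [le_rfl, hH h hmem]
      · push Not at hcov
        by_contra! hlt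
        -- A successor cheaper than `s` is the new least phase start; the induction hypothesis gives
        -- it value `1`, which exceeds the value of `s`.
        have h1 := ihnew h₁ t' ht' hcov rfl (fun h hmem => ?_) (by simp)
          (Leads.of_le hS ⟨rfl, fun _ _ => le_rfl⟩)
        · linarith [limValue_le_one (S := S) (X := X) (I := I) s]
        · rcases List.mem_cons.1 hmem with rfl | hmem
          exacts [hlt.le, hlt.le.trans (hH h hmem)]
    refine ih rfl hH (fun k hk => ?_) (hs.trans hstep)
    rcases List.mem_cons.1 hk with rfl | hk
    exacts [hstep, (hP k hk).trans hstep]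

theorem Win.limValue_eq_one (hS : S.IsOneVASSMDP) {c : Config d n} (hw : Win S X I [c] [] c) :
    S.limValue X I c = 1 :=
  hw.limValue_eq_one_aux hS rfl (by simp) (by simp) (Leads.of_le hS ⟨rfl, fun _ _ => le_rfl⟩)

/-! ### Termination -/

/-- `l'` extends `l` by an element that is not above any element of `l`. -/
def Extends {α : Type*} (r : α → α → Prop) (l' l : List α) : Prop :=
  ∃ a, l' = a :: l ∧ ∀ b ∈ l, ¬ r b a

/-- The elements added along an infinite chain would form a bad sequence for `r`. -/
theorem wellFounded_extends {α : Type*} {r : α → α → Prop} (hr : WellQuasiOrdered r) :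
    WellFounded (Extends r) := by
  rw [wellFounded_iff_isEmpty_descending_chain]
  refine ⟨fun ⟨f, hf⟩ => ?_⟩
  choose a ha hna using hf
  obtain ⟨i, j, hij, hrij⟩ := hr a
  refine hna j (a i) ?_ hrij
  have : ∀ j, i < j → a i ∈ f j := by
    intro j hj
    induction j, hj using Nat.le_induction with
    | base => rw [ha i]; exact List.mem_cons_self
    | succ j _ ih => rw [ha j]; exact List.mem_cons_of_mem _ ih
  exact this j hij

/-- Dickson's lemma, together with finiteness of the control states. -/
theorem wellQuasiOrdered_leAt (I : Finset (Fin d)) :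
    WellQuasiOrdered (leAt I : Config d n → Config d n → Prop) := by
  intro f
  have h1 : WellQuasiOrdered ((· = ·) : Fin n → Fin n → Prop) := by
    intro g
    obtain ⟨i, j, hij, h⟩ := Finite.exists_ne_map_eq_of_infinite g
    rcases hij.lt_or_gt with h' | h'
    exacts [⟨i, j, h', h⟩, ⟨j, i, h', h.symm⟩]
  have h2 : WellQuasiOrdered ((· ≤ ·) : (Fin d → ℕ) → (Fin d → ℕ) → Prop) := wellQuasiOrdered_le
  obtain ⟨i, j, hij, h⟩ := h1.prod h2 f
  exact ⟨i, j, hij, h.1, fun i _ => h.2 i⟩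

theorem wellFounded_extends_leAt (I : Finset (Fin d)) :
    WellFounded (Extends (leAt I : Config d n → Config d n → Prop)) :=
  wellFounded_extends (wellQuasiOrdered_leAt I)

/-- Induction along the moves of the game. -/
theorem position_induction
    {motive : Finset (Fin d) → List (Config d n) → List (Config d n) → Prop}
    (h : ∀ I H P, (∀ I' H' P', I ⊂ I' → motive I' H' P') →
      (∀ H' P', Extends (leAt I) H' H → motive I H' P') →
      (∀ P', Extends (leAt I) P' P → motive I H P') → motive I H P) (I H P) : motive I H P := by
  induction I using WellFoundedGT.induction generalizing H P with
  | ind I ihI =>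
    induction H using (wellFounded_extends_leAt I).induction generalizing P with
    | _ H ihH =>
      induction P using (wellFounded_extends_leAt I).induction with
      | _ P ihP =>
        exact h I H P (fun I' H' P' hI => ihI I' hI H' P') (fun H' P' hH => ihH H' hH P') ihP

theorem ssubset_union_pumped {k c : Config d n} (h : (pumped I k c).Nonempty) :
    I ⊂ I ∪ pumped I k c := by
  obtain ⟨i, hi⟩ := h
  exact Finset.ssubset_iff_subset_ne.2 ⟨Finset.subset_union_left, fun he =>
    (mem_pumped.1 hi).1 (he ▸ Finset.mem_union_right _ hi)⟩

/-! ### Completeness -/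

variable (S X) in
/-- The path `P`, `c` (latest configuration first) can be prolonged inside the set of configurations
of value `1` until it meets the target or increases a counter. -/
inductive Plan (I : Finset (Fin d)) : List (Config d n) → Config d n → Prop
  | target {P c} : c.1 ∈ X → Plan I P c
  | pump {P c k} : k ∈ P → leAt I k c → (pumped I k c).Nonempty → Plan I P c
  | step {P c t} : (∀ k ∈ P, ¬ leAt I k c) → t ∈ S.enabledAt I c →
      S.limValue X I (fireAt I t c) = 1 → Plan I (c :: P) (fireAt I t c) → Plan I P c

/-- A leaf that repeats without pumping lies below an ancestor, so its value can only be bounded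
relative to the ancestors. Hence the conditional form, with `B` free so that children can share one
bound and `b` independent of `N` so that it survives the limit. -/
theorem exists_bound_of_not_plan (hS : S.IsOneVASSMDP) {P : List (Config d n)} {c : Config d n}
    (h : ¬ Plan S X I P c) : ∃ b : ℝ, 0 ≤ b ∧ b < 1 ∧ ∀ N B, b ≤ B →
      (∀ k ∈ P, S.stepValue X I N k ≤ B) → S.stepValue X I N c ≤ B := by
  induction P using (wellFounded_extends_leAt I).induction generalizing c with
  | _ P ih =>
    by_cases hrep : ∃ k ∈ P, leAt I k c
    · obtain ⟨k, hk, hle⟩ := hrep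
      exact ⟨0, le_rfl, one_pos, fun N B _ hB =>
        ((hle.symm fun hne => h (.pump hk hle hne)).stepValue_le hS N).trans (hB k hk)⟩
    push Not at hrep
    have hX : c.1 ∉ X := fun hX => h (.target hX)
    have hsucc : ∀ t ∈ S.enabledAt I c, ∃ b : ℝ, 0 ≤ b ∧ b < 1 ∧ ∀ N B, b ≤ B →
        (∀ k ∈ c :: P, S.stepValue X I N k ≤ B) → S.stepValue X I N (fireAt I t c) ≤ B := by
      intro t ht
      rcases (limValue_le_one (S := S) (X := X) (I := I) (fireAt I t c)).lt_or_eq with hlt | heq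
      -- Leaving the value-`1` set ends the exploration: the value of the successor is itself a
      -- bound below `1`.
      · exact ⟨_, limValue_nonneg _, hlt, fun N B hB _ => (stepValue_le_limValue N _).trans hB⟩
      · exact ih (c :: P) ⟨c, rfl, hrep⟩ fun hp => h (.step hrep ht heq hp)
    choose! b hb0 hb1 hb using hsucc
    obtain ⟨b', hb'0, hb'1, hb'⟩ : ∃ b' : ℝ, 0 ≤ b' ∧ b' < 1 ∧ ∀ t ∈ S.enabledAt I c, b t ≤ b' := by
      rcases (S.enabledAt I c).eq_empty_or_nonempty with he | hne
      · exact ⟨0, le_rfl, one_pos, by simp [he]⟩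
      · obtain ⟨t, ht, hmax⟩ := Finset.exists_max_image _ b hne
        exact ⟨b t, hb0 t ht, hb1 t ht, hmax⟩
    -- Successors have `c` among their ancestors. Induction on `N` breaks the circle: `c` at `N + 1`
    -- needs its successors, and thus `c`, only at `N`.
    refine ⟨b', hb'0, hb'1, fun N B hB => ?_⟩
    induction N with
    | zero =>
      intro _
      simpa [stepValue, hX] using hb'0.trans hB
    | succ N ihN =>
      intro hP
      have hP' : ∀ k ∈ P, S.stepValue X I N k ≤ B :=
        fun k hk => (stepValue_mono k N.le_succ).trans (hP k hk)
      refine stepValue_le_of_forall (hb'0.trans hB) hX fun t ht =>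
        hb t ht N B ((hb' t ht).trans hB) fun k hk => ?_
      rcases List.mem_cons.1 hk with rfl | hk
      exacts [ihN hP', hP' k hk]

theorem plan_of_limValue_eq_one (hS : S.IsOneVASSMDP) {c : Config d n}
    (h : S.limValue X I c = 1) : Plan S X I [] c := by
  by_contra hp
  obtain ⟨b, -, hb1, hb⟩ := exists_bound_of_not_plan hS hp
  have := limValue_le fun N => hb N b le_rfl (by simp)
  linarith

/-- The strategy is to stay at value `1`: follow the plan, and make a fresh plan whenever the
opponent restarts or counters become unbounded. The order of the game bounds how often this happens.
-/
theorem win_of_plan (hS : S.IsOneVASSMDP) (H P : List (Config d n)) {c : Config d n}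
    (hc : S.limValue X I c = 1) (hP : ∀ k ∈ P, S.limValue X I k = 1) (h : Plan S X I P c) :
    Win S X I H P c := by
  induction I, H, P using position_induction generalizing c with
  | h I H P ihI ihH ihP =>
    cases h with
    | target hX => exact .target hX
    | @pump _ _ k hk hle hne =>
      have hk1 : S.limValue X (I ∪ pumped I k c) k = 1 := by
        refine (limValue_le_one _).antisymm ((hP k hk).ge.trans ?_)
        exact limValue_le_limValue hS Finset.subset_union_left rfl fun _ _ => le_rfl
      exact .pump hk hle hne (ihI _ _ _ (ssubset_union_pumped hne) hk1 (by simp)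
        (plan_of_limValue_eq_one hS hk1))
    | @step _ _ t hrep ht ht1 hplan =>
      by_cases hX : c.1 ∈ X
      · exact .target hX
      refine .step hrep ht (fun h₁ t' ht' hcov => ?_)
        (ihP _ ⟨c, rfl, hrep⟩ ht1 (by simpa [hc] using hP) hplan)
      have h1 := limValue_fireAt_eq_one hX h₁ hc ht'
      exact ihH _ _ ⟨_, rfl, hcov⟩ h1 (by simp) (plan_of_limValue_eq_one hS h1)

theorem win_iff_limValue_eq_one (hS : S.IsOneVASSMDP) {c : Config d n} :
    Win S X I [c] [] c ↔ S.limValue X I c = 1 :=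
  ⟨fun h => h.limValue_eq_one hS, fun h => win_of_plan hS _ _ h (by simp)
    (plan_of_limValue_eq_one hS h)⟩

end VASSMDP

/-! ### Finite-horizon reachability probabilities under the play measure -/

namespace MDP

/-- Prolong a finite sequence by one element. -/
def snoc {C : Type} {k : ℕ} (h : Finset.Iic k → C) (c : C) : Finset.Iic (k + 1) → C :=
  fun i => if hi : (i : ℕ) ≤ k then h ⟨i, Finset.mem_Iic.2 hi⟩ else c

theorem last_snoc {C : Type} {k : ℕ} (h : Finset.Iic k → C) (c : C) : last (snoc h c) = c := by
  simp [last, snoc]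

theorem exists_snoc_mem {C : Type} {A : Set C} {k : ℕ} (h : Finset.Iic k → C) (c : C) :
    (∃ i, snoc h c i ∈ A) ↔ (∃ i, h i ∈ A) ∨ c ∈ A := by
  constructor
  · rintro ⟨i, hi⟩
    by_cases hik : (i : ℕ) ≤ k
    · exact .inl ⟨⟨i, Finset.mem_Iic.2 hik⟩, by simpa [snoc, hik] using hi⟩
    · exact .inr (by simpa [snoc, hik] using hi)
  · rintro (⟨i, hi⟩ | hc)
    · have hik : (i : ℕ) ≤ k := Finset.mem_Iic.1 i.2
      exact ⟨⟨i, Finset.mem_Iic.2 (hik.trans k.le_succ)⟩, by simpa [snoc, hik] using hi⟩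
    · exact ⟨⟨k + 1, Finset.mem_Iic.2 le_rfl⟩, by simpa [snoc] using hc⟩

variable {C : Type} [Countable C] [MeasurableSpace C] [MeasurableSingletonClass C]
  {M : MDP C} (σ : M.Strategy)

/-- The law of the first `k + 1` configurations of a play. -/
def historyMeasure (σ : M.Strategy) (k : ℕ) (c : C) : Measure (Finset.Iic k → C) :=
  Kernel.partialTraj (X := fun _ => C) (fun k => M.kernel σ k) 0 k (fun _ => c)

/-- The Markov disintegration of the last step; the only use made of how trajectory kernels are
built step by step. -/
theorem lintegral_historyMeasure_succ (c : C) (k : ℕ) (f : (Finset.Iic (k + 1) → C) → ℝ≥0∞) :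
    ∫⁻ h, f h ∂historyMeasure σ (k + 1) c =
      ∫⁻ h, ∫⁻ c', f (snoc h c') ∂(M.next σ k h).toMeasure ∂historyMeasure σ k c := by
  rw [historyMeasure, Kernel.partialTraj_succ_eq_comp (Nat.zero_le k),
    Kernel.lintegral_comp _ _ _ (measurable_of_countable _)]
  refine lintegral_congr fun h => ?_
  rw [Kernel.partialTraj_succ_self,
    Kernel.lintegral_map _ (by fun_prop) _ (measurable_of_countable _),
    Kernel.lintegral_id_prod (measurable_of_countable _),
    Kernel.lintegral_map _ (by fun_prop) _ (measurable_of_countable _)]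
  refine lintegral_congr fun c' => congrArg f (funext fun i => ?_)
  simp only [IicProdIoc, snoc]
  split_ifs with hi
  · rfl
  · obtain ⟨i, hi'⟩ := i
    obtain rfl : i = k + 1 := by
      have := Finset.mem_Iic.1 hi'
      simp only at hi
      omega
    rfl

theorem lintegral_historyMeasure_zero (c : C) (f : (Finset.Iic 0 → C) → ℝ≥0∞) :
    ∫⁻ h, f h ∂historyMeasure σ 0 c = f fun _ => c := by
  rw [historyMeasure, Kernel.partialTraj_self, Kernel.id_apply,
    lintegral_dirac' _ (measurable_of_countable _)]

theorem playMeasure_visit (c : C) (A : Set C) (N : ℕ) :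
    M.playMeasure c σ {ω | ∃ k ≤ N, ω k ∈ A} = historyMeasure σ N c {h | ∃ i, h i ∈ A} := by
  rw [historyMeasure, ← Kernel.traj_map_frestrictLe_apply (X := fun _ => C),
    Measure.map_apply (by fun_prop) (Set.to_countable _).measurableSet]
  refine congrArg _ (Set.ext fun ω => ⟨?_, ?_⟩)
  · rintro ⟨k, hk, hA⟩
    exact ⟨⟨k, Finset.mem_Iic.2 hk⟩, hA⟩
  · rintro ⟨i, hA⟩
    exact ⟨i, Finset.mem_Iic.1 i.2, hA⟩

open Classical in
/-- An estimate, after the history `h`, of the probability to visit `A` within `N` steps: `1` if `A`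
has been visited, and otherwise given by `u`. -/
def potential (A : Set C) (u : ℕ → C → ℝ≥0∞) (N k : ℕ) (h : Finset.Iic k → C) : ℝ≥0∞ :=
  if ∃ i, h i ∈ A then 1 else u (N - k) (last h)

variable {A : Set C} {u : ℕ → C → ℝ≥0∞}

theorem lintegral_potential_zero (hu : ∀ k, ∀ c ∈ A, u k c = 1) (N : ℕ) (c : C) :
    ∫⁻ h, potential A u N 0 h ∂historyMeasure σ 0 c = u N c := by
  rw [lintegral_historyMeasure_zero]
  simp only [potential, last, tsub_zero]
  split_ifs with h
  · obtain ⟨-, hc⟩ := h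
    exact (hu N c hc).symm
  · rfl

theorem lintegral_potential_self (hu₀ : ∀ c ∉ A, u 0 c = 0) (N : ℕ) (c : C) :
    ∫⁻ h, potential A u N N h ∂historyMeasure σ N c =
      M.playMeasure c σ {ω | ∃ k ≤ N, ω k ∈ A} := by
  rw [playMeasure_visit, ← lintegral_indicator_one (Set.to_countable _).measurableSet]
  refine lintegral_congr fun h => ?_
  by_cases hA : ∃ i, h i ∈ A
  · rw [potential, if_pos hA, Set.indicator_of_mem (Set.mem_ofPred_eq ▸ hA), Pi.one_apply]
  · rw [potential, if_neg hA, Set.indicator_of_notMem (Set.mem_ofPred_eq ▸ hA), tsub_self]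
    exact hu₀ _ fun h' => hA ⟨_, h'⟩

open Classical in
theorem lintegral_potential_snoc {C : Type} [MeasurableSpace C] {M : MDP C} (σ : M.Strategy)
    {A : Set C} {u : ℕ → C → ℝ≥0∞} (hu : ∀ k, ∀ c ∈ A, u k c = 1) (N k : ℕ)
    (h : Finset.Iic k → C) :
    ∫⁻ c', potential A u N (k + 1) (snoc h c') ∂(M.next σ k h).toMeasure =
      if ∃ i, h i ∈ A then 1 else ∫⁻ c', u (N - (k + 1)) c' ∂(M.next σ k h).toMeasure := by
  have := PMF.toMeasure.isProbabilityMeasure (M.next σ k h)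
  split_ifs with hA
  · simp only [potential, exists_snoc_mem, hA, true_or, if_true, lintegral_one, measure_univ]
  · refine lintegral_congr fun c' => ?_
    simp only [potential, exists_snoc_mem, hA, last_snoc, false_or]
    split_ifs with hc
    · exact (hu _ _ hc).symm
    · rfl

/-- Under `hle` the potential is a supermartingale: its mean is `u N c` at time `0` and the visiting
probability at time `N`. -/
theorem playMeasure_visit_le (hu : ∀ k, ∀ c ∈ A, u k c = 1) (hu₀ : ∀ c ∉ A, u 0 c = 0) {N : ℕ}
    (hle : ∀ m k (h : Finset.Iic k → C), last h ∉ A → m + (k + 1) = N →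
      ∫⁻ c', u m c' ∂(M.next σ k h).toMeasure ≤ u (m + 1) (last h)) (c : C) :
    M.playMeasure c σ {ω | ∃ k ≤ N, ω k ∈ A} ≤ u N c := by
  have key : ∀ k ≤ N, ∫⁻ h, potential A u N k h ∂historyMeasure σ k c ≤ u N c := by
    intro k hk
    induction k with
    | zero => exact (lintegral_potential_zero σ hu N c).le
    | succ k ih =>
      refine le_trans ?_ (ih (Nat.le_of_succ_le hk))
      rw [lintegral_historyMeasure_succ]
      refine lintegral_mono fun h => ?_
      rw [lintegral_potential_snoc σ hu, potential]
      split_ifs with hA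
      · rfl
      · have := hle (N - (k + 1)) k h (fun h' => hA ⟨_, h'⟩) (by omega)
        rwa [show N - (k + 1) + 1 = N - k by omega] at this
  exact (lintegral_potential_self σ hu₀ N c).ge.trans (key N le_rfl)

/-- The submartingale counterpart. Only `m = N - (k + 1)` is required in `hle`, since an optimal
strategy depends on the remaining time. -/
theorem le_playMeasure_visit (hu : ∀ k, ∀ c ∈ A, u k c = 1) (hu₀ : ∀ c ∉ A, u 0 c = 0) {N : ℕ}
    (hle : ∀ m k (h : Finset.Iic k → C), last h ∉ A → m + (k + 1) = N →
      u (m + 1) (last h) ≤ ∫⁻ c', u m c' ∂(M.next σ k h).toMeasure) (c : C) :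
    u N c ≤ M.playMeasure c σ {ω | ∃ k ≤ N, ω k ∈ A} := by
  have key : ∀ k ≤ N, u N c ≤ ∫⁻ h, potential A u N k h ∂historyMeasure σ k c := by
    intro k hk
    induction k with
    | zero => exact (lintegral_potential_zero σ hu N c).ge
    | succ k ih =>
      refine (ih (Nat.le_of_succ_le hk)).trans ?_
      rw [lintegral_historyMeasure_succ]
      refine lintegral_mono fun h => ?_
      rw [lintegral_potential_snoc σ hu, potential]
      split_ifs with hA
      · rfl
      · have := hle (N - (k + 1)) k h (fun h' => hA ⟨_, h'⟩) (by omega)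
        rwa [show N - (k + 1) + 1 = N - k by omega] at this
  exact (key N le_rfl).trans (lintegral_potential_self σ hu₀ N c).le

theorem playMeasure_eventually (c : C) :
    M.playMeasure c σ {ω | ∃ k, ω k ∈ A} = ⨆ N, M.playMeasure c σ {ω | ∃ k ≤ N, ω k ∈ A} := by
  rw [← Monotone.measure_iUnion]
  · refine congrArg _ (Set.ext fun ω => ?_)
    simp only [Set.mem_ofPred_eq, Set.mem_iUnion]
    exact ⟨fun ⟨k, hk⟩ => ⟨k, k, le_rfl, hk⟩, fun ⟨_, k, _, hk⟩ => ⟨k, hk⟩⟩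
  · rintro N N' hN ω ⟨k, hk, hA⟩
    exact ⟨k, hk.trans hN, hA⟩

end MDP

/-! ### The value of the induced MDP equals the recursive value -/

namespace VASSMDP

variable {d n : ℕ} {S : VASSMDP d n} {X : Finset (Fin n)}

variable (S X) in
/-- `stepValue` with all counters bounded, as an extended nonnegative real. -/
def optReach (k : ℕ) (c : Config d n) : ℝ≥0∞ := ENNReal.ofReal (S.stepValue X ∅ k c)

theorem step_iff (c c' : Config d n) :
    S.toMDP.step c c' ↔ ∃ t ∈ S.enabled c, fire t c = c' := Iff.rfl

theorem lintegral_pure (c : Config d n) (f : Config d n → ℝ≥0∞) :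
    ∫⁻ c', f c' ∂(PMF.pure c).toMeasure = f c := by
  rw [PMF.toMeasure_pure, lintegral_dirac]

theorem lintegral_prob (c : Config d n) (h h') (f : Config d n → ℝ≥0∞) :
    ∫⁻ c', f c' ∂(S.toMDP.prob c h h').toMeasure =
      (∑ t ∈ S.enabled c, S.τ t * f (fire t c)) / ∑ t ∈ S.enabled c, (S.τ t : ℝ≥0∞) := by
  classical
  rw [lintegral_countable', ← tsum_weight, div_eq_mul_inv]
  simp only [PMF.toMeasure_apply_singleton _ _ (measurableSet_singleton _)]
  -- Unfolds `PMF.normalize`; the hidden factor is the inverse of the total weight.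
  change ∑' a, f a * (S.weight c a * _) = _
  simp only [← mul_assoc]
  rw [ENNReal.tsum_mul_right]
  congr 1
  rw [tsum_eq_sum (s := (S.enabled c).image (fun t => fire t c))]
  · rw [← Finset.sum_fiberwise_of_maps_to (g := fun t => fire t c)
      (fun t ht => Finset.mem_image_of_mem _ ht)]
    refine Finset.sum_congr rfl fun c' _ => ?_
    rw [weight, mul_comm, Finset.sum_mul]
    exact Finset.sum_congr rfl fun t ht => by rw [(Finset.mem_filter.1 ht).2]
  · intro c' hc'
    by_contra h0
    obtain ⟨t, ht, rfl⟩ := (S.weight_ne_zero c c').1 (right_ne_zero_of_mul h0)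
    exact hc' (Finset.mem_image_of_mem _ ht)

theorem optReach_of_mem (k : ℕ) (c : Config d n) (hc : c.1 ∈ X) : S.optReach X k c = 1 := by
  simp [optReach, stepValue_of_mem hc]

theorem optReach_zero (c : Config d n) (hc : c.1 ∉ X) : S.optReach X 0 c = 0 := by
  simp [optReach, stepValue, hc]

theorem optReach_random {c : Config d n} (hX : c.1 ∉ X) (h₁ : c.1 ∉ S.Q₁) {t}
    (ht : t ∈ S.enabled c) (k : ℕ) :
    S.optReach X (k + 1) c = (∑ t ∈ S.enabled c, S.τ t * S.optReach X k (fire t c)) /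
      ∑ t ∈ S.enabled c, (S.τ t : ℝ≥0∞) := by
  rw [← enabledAt_empty] at ht
  rw [optReach, stepValue_random hX h₁, ENNReal.ofReal_div_of_pos (sum_weight_pos ht),
    ENNReal.ofReal_sum_of_nonneg fun _ _ => mul_nonneg (Nat.cast_nonneg _) (stepValue_nonneg _ _),
    ENNReal.ofReal_sum_of_nonneg fun _ _ => Nat.cast_nonneg _]
  simp only [ENNReal.ofReal_mul (Nat.cast_nonneg _), ENNReal.ofReal_natCast, enabledAt_empty,
    fireAt_empty, optReach]

theorem optReach_le_of_enabled {c : Config d n} (hX : c.1 ∉ X) (h₁ : c.1 ∈ S.Q₁) {t}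
    (ht : t ∈ S.enabled c) (k : ℕ) : S.optReach X k (fire t c) ≤ S.optReach X (k + 1) c := by
  rw [← enabledAt_empty] at ht
  rw [optReach, optReach, stepValue_player hX h₁, ← fireAt_empty]
  exact ENNReal.ofReal_le_ofReal (le_ciSup (f := fun t : S.enabledAt ∅ c =>
    S.stepValue X ∅ k (fireAt ∅ t c)) (Set.finite_range _).bddAbove ⟨t, ht⟩)

theorem exists_optReach_le {c : Config d n} (hX : c.1 ∉ X) (h₁ : c.1 ∈ S.Q₁)
    (h : (S.enabled c).Nonempty) (k : ℕ) :
    ∃ t ∈ S.enabled c, S.optReach X (k + 1) c ≤ S.optReach X k (fire t c) := by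
  obtain ⟨t, ht, hmax⟩ := Finset.exists_max_image _ (fun t => S.stepValue X ∅ k (fire t c)) h
  refine ⟨t, ht, ENNReal.ofReal_le_ofReal ?_⟩
  rw [stepValue_player hX h₁]
  refine Real.iSup_le (fun t' => ?_) (stepValue_nonneg _ _)
  rw [fireAt_empty]
  exact hmax t' (enabledAt_empty (S := S) ▸ t'.2)

theorem lintegral_next_le (σ : S.toMDP.Strategy) {k : ℕ} (h : Finset.Iic k → Config d n)
    (hX : (MDP.last h).1 ∉ X) (m : ℕ) :
    ∫⁻ c', S.optReach X m c' ∂(S.toMDP.next σ k h).toMeasure ≤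
      S.optReach X (m + 1) (MDP.last h) := by
  rw [MDP.next]
  split_ifs with hs h₁
  · rw [lintegral_pure]
    obtain ⟨t, ht, heq⟩ := (step_iff _ _).1 (σ.legal k h h₁ hs)
    rw [← heq]
    exact optReach_le_of_enabled hX h₁ ht m
  · obtain ⟨c', t, ht, -⟩ := hs
    rw [lintegral_prob, optReach_random hX h₁ ht]
  · rw [lintegral_pure]
    exact ENNReal.ofReal_le_ofReal (stepValue_mono _ m.le_succ)

/-- The length of the history reveals the remaining time, so a maximising transition for that
horizon can be chosen at each step. -/
theorem exists_optimal_strategy (S : VASSMDP d n) (X : Finset (Fin n)) (N : ℕ) :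
    ∃ σ : S.toMDP.Strategy, ∀ m k (h : Finset.Iic k → Config d n), (MDP.last h).1 ∉ X →
      m + (k + 1) = N → S.optReach X (m + 1) (MDP.last h) ≤
        ∫⁻ c', S.optReach X m c' ∂(S.toMDP.next σ k h).toMeasure := by
  have hch : ∀ (k : ℕ) (h : Finset.Iic k → Config d n), ∃ c', (MDP.last h ∈ S.toMDP.C₁ →
      (∃ c', S.toMDP.step (MDP.last h) c') → S.toMDP.step (MDP.last h) c' ∧
        ((MDP.last h).1 ∉ X →
          S.optReach X (N - (k + 1) + 1) (MDP.last h) ≤ S.optReach X (N - (k + 1)) c')) := by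
    intro k h
    by_cases hs : MDP.last h ∈ S.toMDP.C₁ ∧ ∃ c', S.toMDP.step (MDP.last h) c'
    · obtain ⟨h₁, c', t, ht, heq⟩ := hs
      by_cases hX : (MDP.last h).1 ∈ X
      · exact ⟨c', fun _ _ => ⟨⟨t, ht, heq⟩, fun h' => absurd hX h'⟩⟩
      · obtain ⟨t', ht', hle⟩ := exists_optReach_le hX h₁ ⟨t, ht⟩ (N - (k + 1))
        exact ⟨_, fun _ _ => ⟨⟨t', ht', rfl⟩, fun _ => hle⟩⟩
    · exact ⟨MDP.last h, fun h₁ h₂ => absurd ⟨h₁, h₂⟩ hs⟩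
  choose choice hchoice using hch
  refine ⟨⟨choice, fun k h h₁ hs => (hchoice k h h₁ hs).1⟩, fun m k h hX hN => ?_⟩
  obtain rfl : m = N - (k + 1) := by omega
  rw [MDP.next]
  split_ifs with hs h₁
  · rw [lintegral_pure]
    exact (hchoice k h h₁ hs).2 hX
  · obtain ⟨c', t, ht, -⟩ := hs
    rw [lintegral_prob, optReach_random hX h₁ ht]
  · rw [lintegral_pure]
    -- In a deadlock there is no successor to check, so any nonnegative bound is admissible.
    refine ENNReal.ofReal_le_ofReal (stepValue_le_of_forall (stepValue_nonneg _ _) hX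
      fun t ht => absurd ⟨_, t, ?_, rfl⟩ hs)
    rwa [enabledAt_empty] at ht

/-- Both sides are suprema over horizons: the event is the increasing union of its `N`-step
versions, and suprema over `N` and over strategies commute. No single strategy need be optimal. -/
theorem value_reach (c : Config d n) :
    S.toMDP.value c (reach X) = ENNReal.ofReal (S.limValue X ∅ c) := by
  have h0 : ENNReal.ofReal (S.limValue X ∅ c) = ⨆ N, S.optReach X N c :=
    tendsto_nhds_unique (ENNReal.tendsto_ofReal (tendsto_stepValue c))
      (tendsto_atTop_iSup fun _ _ h => ENNReal.ofReal_le_ofReal (stepValue_mono c h))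
  have h1 : ∀ σ : S.toMDP.Strategy, S.toMDP.playMeasure c σ (reach X) =
      ⨆ N, S.toMDP.playMeasure c σ {ω | ∃ k ≤ N, ω k ∈ {c' : Config d n | c'.1 ∈ X}} :=
    fun σ => MDP.playMeasure_eventually σ (A := {c' : Config d n | c'.1 ∈ X}) c
  rw [h0, MDP.value]
  refine le_antisymm (iSup_le fun σ => ?_) (iSup_le fun N => ?_)
  · rw [h1]
    refine iSup_mono fun N => ?_
    exact MDP.playMeasure_visit_le σ (fun k c => optReach_of_mem k c) (fun c => optReach_zero c)
      (fun m k h hX _ => lintegral_next_le σ h hX m) c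
  · obtain ⟨σ, hσ⟩ := exists_optimal_strategy S X N
    refine le_trans ?_ (le_iSup _ σ)
    rw [h1]
    exact (MDP.le_playMeasure_visit σ (A := {c' : Config d n | c'.1 ∈ X})
      (fun k c => optReach_of_mem k c) (fun c => optReach_zero c) hσ c).trans
      (le_iSup (fun N => S.toMDP.playMeasure c σ {ω | ∃ k ≤ N, ω k ∈ {c' : Config d n | c'.1 ∈ X}}) N)

theorem limitSureReach_iff_win (hS : S.IsOneVASSMDP) {c : Config d n} :
    S.LimitSureReach c X ↔ Win S X ∅ [c] [] c := by
  rw [win_iff_limValue_eq_one hS, LimitSureReach, value_reach, ENNReal.ofReal_eq_one]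

end VASSMDP

/-! ### Primitive recursive and recursively enumerable predicates -/

section Primrec

variable {α β : Type*} [Primcodable α] [Primcodable β]

theorem PrimrecPred.forall_mem_comp {f : α → List β} {p : α → β → Prop} (hf : Primrec f)
    (hp : PrimrecPred fun x : α × β => p x.1 x.2) : PrimrecPred fun a => ∀ b ∈ f a, p a b :=
  (PrimrecRel.forall_mem_list (R := fun b a => p a b)
    (hp.comp (Primrec.pair Primrec.snd Primrec.fst))).comp hf Primrec.id

theorem PrimrecPred.exists_mem_comp {f : α → List β} {p : α → β → Prop} (hf : Primrec f)
    (hp : PrimrecPred fun x : α × β => p x.1 x.2) : PrimrecPred fun a => ∃ b ∈ f a, p a b :=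
  (PrimrecRel.exists_mem_list (R := fun b a => p a b)
    (hp.comp (Primrec.pair Primrec.snd Primrec.fst))).comp hf Primrec.id

theorem PrimrecPred.forall_lt_comp {f : α → ℕ} {p : α → ℕ → Prop} (hf : Primrec f)
    (hp : PrimrecPred fun x : α × ℕ => p x.1 x.2) : PrimrecPred fun a => ∀ i < f a, p a i :=
  (PrimrecPred.forall_mem_comp (Primrec.list_range.comp hf) hp).of_eq fun a => by simp

theorem PrimrecPred.exists_lt_comp {f : α → ℕ} {p : α → ℕ → Prop} (hf : Primrec f)
    (hp : PrimrecPred fun x : α × ℕ => p x.1 x.2) : PrimrecPred fun a => ∃ i < f a, p a i :=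
  (PrimrecPred.exists_mem_comp (Primrec.list_range.comp hf) hp).of_eq fun a => by simp

theorem PrimrecPred.mem_comp {f : α → β} {l : α → List β} (hf : Primrec f) (hl : Primrec l) :
    PrimrecPred fun a => f a ∈ l a :=
  (PrimrecPred.exists_mem_comp (p := fun a b => b = f a) hl
    (Primrec.eq.comp Primrec.snd (hf.comp Primrec.fst))).of_eq fun a => by simp

theorem PrimrecPred.rePred_exists {p : α → β → Prop}
    (hp : PrimrecPred fun x : α × β => p x.1 x.2) : REPred fun a => ∃ b, p a b := by
  classical
  have h1 : PrimrecPred fun x : α × ℕ => ∃ b ∈ (Encodable.decode (α := β) x.2).toList, p x.1 b :=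
    PrimrecPred.exists_mem_comp (p := fun (x : α × ℕ) b => p x.1 b)
      (Primrec.optionToList.comp (Primrec.decode.comp Primrec.snd))
      (hp.comp (Primrec.pair (Primrec.fst.comp Primrec.fst) Primrec.snd))
  have h2 : Computable₂ fun (a : α) (m : ℕ) =>
      decide (∃ b ∈ (Encodable.decode (α := β) m).toList, p a b) := h1.decide.to_comp
  refine (Partrec.dom_re (Partrec.rfind h2.partrec₂)).of_eq fun a => ?_
  rw [Nat.rfind_dom]
  constructor
  · rintro ⟨m, hm, -⟩
    obtain ⟨b, -, hb⟩ : ∃ b ∈ (Encodable.decode (α := β) m).toList, p a b := by simpa using hm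
    exact ⟨b, hb⟩
  · rintro ⟨b, hb⟩
    exact ⟨Encodable.encode b, by simpa using hb, fun _ => trivial⟩

/-- The encoding of integers sends `m` to `2 * m` and `-(m + 1)` to `2 * m + 1`, so sign and size
are read off by parity and halving. -/
theorem Primrec.int_toNat : Primrec Int.toNat := by
  refine (Primrec.ite (Primrec.eq.comp (Primrec.nat_mod.comp Primrec.encode (Primrec.const 2))
    (Primrec.const 0)) (Primrec.nat_div.comp Primrec.encode (Primrec.const 2))
    (Primrec.const 0)).of_eq fun z => ?_
  cases z with
  | ofNat m =>
    change (if 2 * m % 2 = 0 then 2 * m / 2 else 0) = m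
    simp
  | negSucc m =>
    change (if (2 * m + 1) % 2 = 0 then (2 * m + 1) / 2 else 0) = 0
    simp

theorem Primrec.int_toNat_neg : Primrec fun z : ℤ => (-z).toNat := by
  refine (Primrec.ite (Primrec.eq.comp (Primrec.nat_mod.comp Primrec.encode (Primrec.const 2))
    (Primrec.const 0)) (Primrec.const 0) (Primrec.succ.comp
      (Primrec.nat_div.comp Primrec.encode (Primrec.const 2)))).of_eq fun z => ?_
  cases z with
  | ofNat m =>
    change (if 2 * m % 2 = 0 then 0 else 2 * m / 2 + 1) = (-(m : ℤ)).toNat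
    simp
  | negSucc m =>
    change (if (2 * m + 1) % 2 = 0 then 0 else (2 * m + 1) / 2 + 1) = m + 1
    rw [if_neg (by omega)]
    omega

end Primrec

/-! ### The game on codes -/

namespace VASSMDP

namespace Code

/-- Codes of configurations. -/
abbrev Conf : Type := ℕ × List ℕ

/-- Codes of weighted transitions. -/
abbrev Trans : Type := (ℕ × List ℤ × ℕ) × ℕ

/-- Codes of game positions. -/
abbrev Pos : Type := List Bool × List Conf × List Conf × Conf

/-- Is the counter `i` unbounded? -/
def bit (I : List Bool) (i : ℕ) : Bool := I.getD i false

/-- The value of the counter `i`. -/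
def counter (c : Conf) (i : ℕ) : ℕ := c.2.getD i 0

/-- The effect of a transition on the counter `i`. -/
def effect (t : Trans) (i : ℕ) : ℤ := t.1.2.1.getD i 0

/-- `VASSMDP.leAt` on codes. -/
def LeAt (d : ℕ) (I : List Bool) (k c : Conf) : Prop :=
  k.1 = c.1 ∧ ∀ i < d, bit I i = true ∨ counter k i ≤ counter c i

/-- Nonemptiness of `VASSMDP.pumped` on codes. -/
def Pumps (d : ℕ) (I : List Bool) (k c : Conf) : Prop :=
  ∃ i < d, bit I i = false ∧ counter k i < counter c i

/-- Membership in `VASSMDP.enabledAt` on codes. -/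
def Enabled (d : ℕ) (I : List Bool) (t : Trans) (c : Conf) : Prop :=
  t.1.1 = c.1 ∧ ∀ i < d, bit I i = true ∨ (-effect t i).toNat ≤ counter c i + (effect t i).toNat

/-- `VASSMDP.fireAt` on codes. -/
def fire (d : ℕ) (I : List Bool) (t : Trans) (c : Conf) : Conf :=
  (t.1.2.2, (List.range d).map fun i =>
    if bit I i = true then counter c i
    else counter c i + (effect t i).toNat - (-effect t i).toNat)

/-- The unbounded counters after a phase from `k` to `c`. -/
def release (d : ℕ) (I : List Bool) (k c : Conf) : List Bool :=
  (List.range d).map fun i => bit I i || decide (counter k i < counter c i)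

/-- The position in which the pumped counters become unbounded. -/
def dropPos (d : ℕ) (p : Pos) (k : Conf) : Pos := (release d p.1 k p.2.2.2, [k], [], k)

/-- The position in which the opponent has started a new phase with `t`. -/
def newPos (d : ℕ) (p : Pos) (t : Trans) : Pos :=
  (p.1, fire d p.1 t p.2.2.2 :: p.2.1, [], fire d p.1 t p.2.2.2)

/-- The position in which `t` has prolonged the current phase. -/
def nextPos (d : ℕ) (p : Pos) (t : Trans) : Pos :=
  (p.1, p.2.1, p.2.2.2 :: p.2.2.1, fire d p.1 t p.2.2.2)

/-- The control state is a target. -/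
def Target (w : Code) (c : Conf) : Prop := w.2.2.2.2.getD c.1 false = true

/-- The control state belongs to Player 1. -/
def Player (w : Code) (c : Conf) : Prop := w.2.1.getD c.1 false = true

/-- Firing `t` leads above the first configuration of some phase. -/
def Covered (d : ℕ) (p : Pos) (t : Trans) : Prop :=
  ∃ h ∈ p.2.1, LeAt d p.1 h (fire d p.1 t p.2.2.2)

/-- The current configuration is above an earlier one of its phase. -/
def Repeats (d : ℕ) (p : Pos) : Prop := ∃ k ∈ p.2.2.1, LeAt d p.1 k p.2.2.2

/-- The position `p` is winning, given that the positions labelled `true` in `L` are. -/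
def LocalWin (w : Code) (L : List (Pos × Bool)) (p : Pos) : Prop :=
  Target w p.2.2.2 ∨
  (∃ k ∈ p.2.2.1, LeAt w.1 p.1 k p.2.2.2 ∧ Pumps w.1 p.1 k p.2.2.2 ∧ (dropPos w.1 p k, true) ∈ L) ∨
  (¬ Repeats w.1 p ∧ ∃ t ∈ w.2.2.1, Enabled w.1 p.1 t p.2.2.2 ∧
    (Player w p.2.2.2 ∨ ∀ t' ∈ w.2.2.1, ¬ Enabled w.1 p.1 t' p.2.2.2 ∨ Covered w.1 p t' ∨
      (newPos w.1 p t', true) ∈ L) ∧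
    (nextPos w.1 p t, true) ∈ L)

/-- The position `p` is losing, given that the positions labelled `false` in `L` are. -/
def LocalLose (w : Code) (L : List (Pos × Bool)) (p : Pos) : Prop :=
  ¬ Target w p.2.2.2 ∧
  (∀ k ∈ p.2.2.1, ¬ LeAt w.1 p.1 k p.2.2.2 ∨ ¬ Pumps w.1 p.1 k p.2.2.2 ∨
    (dropPos w.1 p k, false) ∈ L) ∧
  (Repeats w.1 p ∨ ∀ t ∈ w.2.2.1, ¬ Enabled w.1 p.1 t p.2.2.2 ∨
    (¬ Player w p.2.2.2 ∧ ∃ t' ∈ w.2.2.1, Enabled w.1 p.1 t' p.2.2.2 ∧ ¬ Covered w.1 p t' ∧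
      (newPos w.1 p t', false) ∈ L) ∨
    (nextPos w.1 p t, false) ∈ L)

/-- All labels in `L` are justified by labels in `L`. -/
def Valid (w : Code) (L : List (Pos × Bool)) : Prop :=
  ∀ x ∈ L, (x.2 = true ∧ LocalWin w L x.1) ∨ (x.2 = false ∧ LocalLose w L x.1)

/-- The initial position. -/
def initPos (w : Code) : Pos :=
  ((List.range w.1).map fun _ => false, [w.2.2.2.1], [], w.2.2.2.1)

/-- The code describes a 1-VASS-MDP with an initial configuration and a target set. -/
def WellFormed (w : Code) : Prop :=
  (∀ t ∈ w.2.2.1, (t.1.1 < w.2.1.length ∧ t.1.2.2 < w.2.1.length) ∧ t.1.2.1.length = w.1 ∧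
    0 < t.2 ∧ (w.2.1.getD t.1.1 false = true ∨ ∀ i < w.1, effect t i = 0)) ∧
  (∀ j < w.2.2.1.length, ∀ i < j,
    (w.2.2.1.map fun t => t.1)[i]? ≠ (w.2.2.1.map fun t => t.1)[j]?) ∧
  w.2.2.2.1.1 < w.2.1.length ∧ w.2.2.2.1.2.length = w.1 ∧ w.2.2.2.2.length = w.2.1.length

/-! ### The game on codes is primitive recursive -/

section Primrec

open Primrec (fst snd)

variable {α : Type*} [Primcodable α] {d i : α → ℕ} {I : α → List Bool} {k c : α → Conf}
  {t : α → Trans} {p : α → Pos} {w : α → Code} {L : α → List (Pos × Bool)}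

theorem primrec_bit (hI : Primrec I) (hi : Primrec i) : Primrec fun a => bit (I a) (i a) :=
  (Primrec.list_getD false).comp hI hi

theorem primrec_counter (hc : Primrec c) (hi : Primrec i) :
    Primrec fun a => counter (c a) (i a) :=
  (Primrec.list_getD 0).comp (snd.comp hc) hi

theorem primrec_effect (ht : Primrec t) (hi : Primrec i) : Primrec fun a => effect (t a) (i a) :=
  (Primrec.list_getD 0).comp (fst.comp (snd.comp (fst.comp ht))) hi

theorem primrecPred_eq_true {f : α → Bool} (hf : Primrec f) : PrimrecPred fun a => f a = true :=
  Primrec.eq.comp hf (Primrec.const true)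

theorem primrecPred_leAt (hd : Primrec d) (hI : Primrec I) (hk : Primrec k) (hc : Primrec c) :
    PrimrecPred fun a => LeAt (d a) (I a) (k a) (c a) :=
  (Primrec.eq.comp (fst.comp hk) (fst.comp hc)).and <| PrimrecPred.forall_lt_comp hd <|
    (primrecPred_eq_true (primrec_bit (hI.comp fst) snd)).or <|
      Primrec.nat_le.comp (primrec_counter (hk.comp fst) snd) (primrec_counter (hc.comp fst) snd)

theorem primrecPred_pumps (hd : Primrec d) (hI : Primrec I) (hk : Primrec k) (hc : Primrec c) :
    PrimrecPred fun a => Pumps (d a) (I a) (k a) (c a) :=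
  PrimrecPred.exists_lt_comp hd <|
    (Primrec.eq.comp (primrec_bit (hI.comp fst) snd) (Primrec.const false)).and <|
      Primrec.nat_lt.comp (primrec_counter (hk.comp fst) snd) (primrec_counter (hc.comp fst) snd)

theorem primrecPred_enabled (hd : Primrec d) (hI : Primrec I) (ht : Primrec t) (hc : Primrec c) :
    PrimrecPred fun a => Enabled (d a) (I a) (t a) (c a) :=
  (Primrec.eq.comp (fst.comp (fst.comp ht)) (fst.comp hc)).and <| PrimrecPred.forall_lt_comp hd <|
    (primrecPred_eq_true (primrec_bit (hI.comp fst) snd)).or <|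
      Primrec.nat_le.comp (Primrec.int_toNat_neg.comp (primrec_effect (ht.comp fst) snd))
        (Primrec.nat_add.comp (primrec_counter (hc.comp fst) snd)
          (Primrec.int_toNat.comp (primrec_effect (ht.comp fst) snd)))

theorem primrec_fire (hd : Primrec d) (hI : Primrec I) (ht : Primrec t) (hc : Primrec c) :
    Primrec fun a => fire (d a) (I a) (t a) (c a) := by
  refine (snd.comp (snd.comp (fst.comp ht))).pair (Primrec.list_map (Primrec.list_range.comp hd) ?_)
  exact Primrec.ite (primrecPred_eq_true (primrec_bit (hI.comp fst) snd))
    (primrec_counter (hc.comp fst) snd)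
    (Primrec.nat_sub.comp (Primrec.nat_add.comp (primrec_counter (hc.comp fst) snd)
      (Primrec.int_toNat.comp (primrec_effect (ht.comp fst) snd)))
      (Primrec.int_toNat_neg.comp (primrec_effect (ht.comp fst) snd)))

theorem primrec_release (hd : Primrec d) (hI : Primrec I) (hk : Primrec k) (hc : Primrec c) :
    Primrec fun a => release (d a) (I a) (k a) (c a) := by
  refine Primrec.list_map (Primrec.list_range.comp hd) ?_
  exact Primrec.or.comp (primrec_bit (hI.comp fst) snd)
    (Primrec.nat_lt.comp (primrec_counter (hk.comp fst) snd)
      (primrec_counter (hc.comp fst) snd)).decide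

theorem primrec_frozen (hp : Primrec p) : Primrec fun a => (p a).1 := fst.comp hp

theorem primrec_starts (hp : Primrec p) : Primrec fun a => (p a).2.1 := fst.comp (snd.comp hp)

theorem primrec_past (hp : Primrec p) : Primrec fun a => (p a).2.2.1 :=
  fst.comp (snd.comp (snd.comp hp))

theorem primrec_current (hp : Primrec p) : Primrec fun a => (p a).2.2.2 :=
  snd.comp (snd.comp (snd.comp hp))

theorem primrec_dropPos (hd : Primrec d) (hp : Primrec p) (hk : Primrec k) :
    Primrec fun a => dropPos (d a) (p a) (k a) :=
  (primrec_release hd (primrec_frozen hp) hk (primrec_current hp)).pair <|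
    (Primrec.list_cons.comp hk (Primrec.const [])).pair <| (Primrec.const []).pair hk

theorem primrec_newPos (hd : Primrec d) (hp : Primrec p) (ht : Primrec t) :
    Primrec fun a => newPos (d a) (p a) (t a) :=
  have hf := primrec_fire hd (primrec_frozen hp) ht (primrec_current hp)
  (primrec_frozen hp).pair <| (Primrec.list_cons.comp hf (primrec_starts hp)).pair <|
    (Primrec.const []).pair hf

theorem primrec_nextPos (hd : Primrec d) (hp : Primrec p) (ht : Primrec t) :
    Primrec fun a => nextPos (d a) (p a) (t a) :=
  (primrec_frozen hp).pair <| (primrec_starts hp).pair <|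
    (Primrec.list_cons.comp (primrec_current hp) (primrec_past hp)).pair <|
      primrec_fire hd (primrec_frozen hp) ht (primrec_current hp)

theorem primrecPred_target (hw : Primrec w) (hc : Primrec c) :
    PrimrecPred fun a => Target (w a) (c a) :=
  primrecPred_eq_true <| (Primrec.list_getD false).comp
    (snd.comp (snd.comp (snd.comp (snd.comp hw)))) (fst.comp hc)

theorem primrecPred_player (hw : Primrec w) (hc : Primrec c) :
    PrimrecPred fun a => Player (w a) (c a) :=
  primrecPred_eq_true <| (Primrec.list_getD false).comp (fst.comp (snd.comp hw)) (fst.comp hc)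

theorem primrecPred_covered (hd : Primrec d) (hp : Primrec p) (ht : Primrec t) :
    PrimrecPred fun a => Covered (d a) (p a) (t a) :=
  PrimrecPred.exists_mem_comp (primrec_starts hp) <|
    primrecPred_leAt (hd.comp fst) ((primrec_frozen hp).comp fst) snd
      ((primrec_fire hd (primrec_frozen hp) ht (primrec_current hp)).comp fst)

theorem primrecPred_repeats (hd : Primrec d) (hp : Primrec p) :
    PrimrecPred fun a => Repeats (d a) (p a) :=
  PrimrecPred.exists_mem_comp (primrec_past hp) <|
    primrecPred_leAt (hd.comp fst) ((primrec_frozen hp).comp fst) snd ((primrec_current hp).comp fst)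

theorem primrecPred_mem_label (hp : Primrec p) (hL : Primrec L) (b : Bool) :
    PrimrecPred fun a => (p a, b) ∈ L a :=
  PrimrecPred.mem_comp (hp.pair (Primrec.const b)) hL

theorem primrec_transitions (hw : Primrec w) : Primrec fun a => (w a).2.2.1 :=
  fst.comp (snd.comp (snd.comp hw))

theorem primrecPred_localWin (hw : Primrec w) (hL : Primrec L) (hp : Primrec p) :
    PrimrecPred fun a => LocalWin (w a) (L a) (p a) := by
  have hd : Primrec fun a => (w a).1 := fst.comp hw
  have hI := primrec_frozen hp
  have hc := primrec_current hp
  refine (primrecPred_target hw hc).or (.or ?_ (.and (.not (primrecPred_repeats hd hp)) ?_))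
  · refine PrimrecPred.exists_mem_comp (primrec_past hp) (.and ?_ (.and ?_ ?_))
    · exact primrecPred_leAt (hd.comp fst) (hI.comp fst) snd (hc.comp fst)
    · exact primrecPred_pumps (hd.comp fst) (hI.comp fst) snd (hc.comp fst)
    · exact primrecPred_mem_label (primrec_dropPos (hd.comp fst) (hp.comp fst) snd)
        (hL.comp fst) true
  · refine PrimrecPred.exists_mem_comp (primrec_transitions hw) (.and ?_ (.and (.or ?_ ?_) ?_))
    · exact primrecPred_enabled (hd.comp fst) (hI.comp fst) snd (hc.comp fst)
    · exact primrecPred_player (hw.comp fst) (hc.comp fst)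
    -- The condition on the opponent does not involve the chosen `t`, so it is treated as a
    -- predicate of `a` alone.
    · refine PrimrecPred.comp (p := fun a => ∀ t' ∈ (w a).2.2.1, ¬ Enabled (w a).1 (p a).1 t'
        (p a).2.2.2 ∨ Covered (w a).1 (p a) t' ∨ (newPos (w a).1 (p a) t', true) ∈ L a) ?_ fst
      refine PrimrecPred.forall_mem_comp (primrec_transitions hw) (.or (.not ?_) (.or ?_ ?_))
      · exact primrecPred_enabled (hd.comp fst) (hI.comp fst) snd (hc.comp fst)
      · exact primrecPred_covered (hd.comp fst) (hp.comp fst) snd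
      · exact primrecPred_mem_label (primrec_newPos (hd.comp fst) (hp.comp fst) snd)
          (hL.comp fst) true
    · exact primrecPred_mem_label (primrec_nextPos (hd.comp fst) (hp.comp fst) snd)
        (hL.comp fst) true

theorem primrecPred_localLose (hw : Primrec w) (hL : Primrec L) (hp : Primrec p) :
    PrimrecPred fun a => LocalLose (w a) (L a) (p a) := by
  have hd : Primrec fun a => (w a).1 := fst.comp hw
  have hI := primrec_frozen hp
  have hc := primrec_current hp
  refine .and (.not (primrecPred_target hw hc)) (.and ?_ (.or (primrecPred_repeats hd hp) ?_))
  · refine PrimrecPred.forall_mem_comp (primrec_past hp) (.or (.not ?_) (.or (.not ?_) ?_))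
    · exact primrecPred_leAt (hd.comp fst) (hI.comp fst) snd (hc.comp fst)
    · exact primrecPred_pumps (hd.comp fst) (hI.comp fst) snd (hc.comp fst)
    · exact primrecPred_mem_label (primrec_dropPos (hd.comp fst) (hp.comp fst) snd)
        (hL.comp fst) false
  · refine PrimrecPred.forall_mem_comp (primrec_transitions hw)
      (.or (.not ?_) (.or (.and (.not ?_) ?_) ?_))
    · exact primrecPred_enabled (hd.comp fst) (hI.comp fst) snd (hc.comp fst)
    · exact primrecPred_player (hw.comp fst) (hc.comp fst)
    · refine PrimrecPred.comp (p := fun a => ∃ t' ∈ (w a).2.2.1, Enabled (w a).1 (p a).1 t'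
        (p a).2.2.2 ∧ ¬ Covered (w a).1 (p a) t' ∧ (newPos (w a).1 (p a) t', false) ∈ L a) ?_ fst
      refine PrimrecPred.exists_mem_comp (primrec_transitions hw) (.and ?_ (.and (.not ?_) ?_))
      · exact primrecPred_enabled (hd.comp fst) (hI.comp fst) snd (hc.comp fst)
      · exact primrecPred_covered (hd.comp fst) (hp.comp fst) snd
      · exact primrecPred_mem_label (primrec_newPos (hd.comp fst) (hp.comp fst) snd)
          (hL.comp fst) false
    · exact primrecPred_mem_label (primrec_nextPos (hd.comp fst) (hp.comp fst) snd)
        (hL.comp fst) false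

theorem primrecPred_valid (hw : Primrec w) (hL : Primrec L) :
    PrimrecPred fun a => Valid (w a) (L a) := by
  refine PrimrecPred.forall_mem_comp hL (.or (.and ?_ ?_) (.and ?_ ?_))
  · exact primrecPred_eq_true (snd.comp snd)
  · exact primrecPred_localWin (hw.comp fst) (hL.comp fst) (fst.comp snd)
  · exact Primrec.eq.comp (snd.comp snd) (Primrec.const false)
  · exact primrecPred_localLose (hw.comp fst) (hL.comp fst) (fst.comp snd)

theorem primrec_initPos (hw : Primrec w) : Primrec fun a => initPos (w a) := by
  have hc : Primrec fun a => (w a).2.2.2.1 := fst.comp (snd.comp (snd.comp (snd.comp hw)))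
  refine .pair (Primrec.list_map (Primrec.list_range.comp (fst.comp hw)) ?_) (.pair ?_ (.pair ?_ hc))
  · exact Primrec.const false
  · exact Primrec.list_cons.comp hc (Primrec.const [])
  · exact Primrec.const []

theorem primrecPred_wellFormed (hw : Primrec w) : PrimrecPred fun a => WellFormed (w a) := by
  have hd : Primrec fun a => (w a).1 := fst.comp hw
  have hQ : Primrec fun a => (w a).2.1 := fst.comp (snd.comp hw)
  have hn : Primrec fun a => (w a).2.1.length := Primrec.list_length.comp hQ
  have hT := primrec_transitions hw
  have hc : Primrec fun a => (w a).2.2.2.1 := fst.comp (snd.comp (snd.comp (snd.comp hw)))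
  have hM : Primrec fun a => (w a).2.2.1.map fun t => t.1 := Primrec.list_map hT (fst.comp snd)
  refine .and ?_ (.and ?_ (.and ?_ (.and ?_ ?_)))
  · refine PrimrecPred.forall_mem_comp hT (.and (.and ?_ ?_) (.and ?_ (.and ?_ (.or ?_ ?_))))
    · exact Primrec.nat_lt.comp (fst.comp (fst.comp snd)) (hn.comp fst)
    · exact Primrec.nat_lt.comp (snd.comp (snd.comp (fst.comp snd))) (hn.comp fst)
    · exact Primrec.eq.comp (Primrec.list_length.comp (fst.comp (snd.comp (fst.comp snd))))
        (hd.comp fst)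
    · exact Primrec.nat_lt.comp (Primrec.const 0) (snd.comp snd)
    · exact primrecPred_eq_true
        ((Primrec.list_getD false).comp (hQ.comp fst) (fst.comp (fst.comp snd)))
    · refine PrimrecPred.forall_lt_comp (hd.comp fst) ?_
      exact Primrec.eq.comp (primrec_effect (snd.comp fst) snd) (Primrec.const 0)
  · refine PrimrecPred.forall_lt_comp (Primrec.list_length.comp hT) ?_
    refine PrimrecPred.forall_lt_comp snd (.not ?_)
    exact Primrec.eq.comp (Primrec.list_getElem?.comp (hM.comp (fst.comp fst)) snd)
      (Primrec.list_getElem?.comp (hM.comp (fst.comp fst)) (snd.comp fst))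
  · exact Primrec.nat_lt.comp (fst.comp hc) hn
  · exact Primrec.eq.comp (Primrec.list_length.comp (snd.comp hc)) hd
  · exact Primrec.eq.comp
      (Primrec.list_length.comp (snd.comp (snd.comp (snd.comp (snd.comp hw))))) hn

end Primrec

end Code

end VASSMDP

namespace VASSMDP

variable {d n : ℕ} {S : VASSMDP d n} {X : Finset (Fin n)} {I : Finset (Fin d)}

/-! ### Positions and moves -/

/-- Positions of the game of `Win`. -/
abbrev Position (d n : ℕ) : Type :=
  Finset (Fin d) × List (Config d n) × List (Config d n) × Config d n

/-- The position in which the pumped counters become unbounded. -/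
def dropPosition (p : Position d n) (k : Config d n) : Position d n :=
  (p.1 ∪ pumped p.1 k p.2.2.2, [k], [], k)

/-- The position in which the opponent has started a new phase with `t`. -/
def newPosition (p : Position d n) (t : Fin n × (Fin d → ℤ) × Fin n) : Position d n :=
  (p.1, fireAt p.1 t p.2.2.2 :: p.2.1, [], fireAt p.1 t p.2.2.2)

/-- The position in which `t` has prolonged the current phase. -/
def nextPosition (p : Position d n) (t : Fin n × (Fin d → ℤ) × Fin n) : Position d n :=
  (p.1, p.2.1, p.2.2.2 :: p.2.2.1, fireAt p.1 t p.2.2.2)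

variable (S X) in
/-- Player 1 wins from the position `p`. -/
def Wins (p : Position d n) : Prop := Win S X p.1 p.2.1 p.2.2.1 p.2.2.2

variable (S) in
/-- The moves of the game. -/
inductive Move (p : Position d n) : Position d n → Prop
  | drop {k} : k ∈ p.2.2.1 → leAt p.1 k p.2.2.2 → (pumped p.1 k p.2.2.2).Nonempty →
      Move p (dropPosition p k)
  | new {t} : t ∈ S.enabledAt p.1 p.2.2.2 → (¬ ∃ h ∈ p.2.1, leAt p.1 h (fireAt p.1 t p.2.2.2)) →
      Move p (newPosition p t)
  | next {t} : t ∈ S.enabledAt p.1 p.2.2.2 → (¬ ∃ k ∈ p.2.2.1, leAt p.1 k p.2.2.2) →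
      Move p (nextPosition p t)

/-- The three kinds of move decrease the three components of the lexicographic order of
`position_induction`. -/
theorem move_induction {motive : Position d n → Prop}
    (h : ∀ p, (∀ q, Move S p q → motive q) → motive p) (p : Position d n) : motive p := by
  obtain ⟨I, H, P, c⟩ := p
  induction I, H, P using position_induction generalizing c with
  | h I H P ihI ihH ihP =>
    refine h _ fun q hq => ?_
    cases hq with
    | drop hk hle hne => exact ihI _ _ _ (ssubset_union_pumped hne) _
    | new ht hcov => exact ihH _ _ ⟨_, rfl, fun b hb hle => hcov ⟨b, hb, hle⟩⟩ _
    | next ht hrep => exact ihP _ ⟨_, rfl, fun b hb hle => hrep ⟨b, hb, hle⟩⟩ _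

theorem finite_moves (p : Position d n) : {q | Move S p q}.Finite := by
  refine (((p.2.2.1.finite_toSet.image (dropPosition p)).union
    ((S.enabledAt p.1 p.2.2.2).finite_toSet.image (newPosition p))).union
    ((S.enabledAt p.1 p.2.2.2).finite_toSet.image (nextPosition p))).subset ?_
  intro q hq
  cases hq with
  | drop hk _ _ => exact .inl (.inl ⟨_, hk, rfl⟩)
  | new ht _ => exact .inl (.inr ⟨_, ht, rfl⟩)
  | next ht _ => exact .inr ⟨_, ht, rfl⟩

variable (S X) in
/-- The condition for `p` to be winning, in terms of the set `F` of winning positions. -/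
def WinsNow (F : Position d n → Prop) (p : Position d n) : Prop :=
  p.2.2.2.1 ∈ X ∨
  (∃ k ∈ p.2.2.1, leAt p.1 k p.2.2.2 ∧ (pumped p.1 k p.2.2.2).Nonempty ∧ F (dropPosition p k)) ∨
  ((¬ ∃ k ∈ p.2.2.1, leAt p.1 k p.2.2.2) ∧ ∃ t ∈ S.enabledAt p.1 p.2.2.2,
    (p.2.2.2.1 ∈ S.Q₁ ∨ ∀ t' ∈ S.enabledAt p.1 p.2.2.2,
      (∃ h ∈ p.2.1, leAt p.1 h (fireAt p.1 t' p.2.2.2)) ∨ F (newPosition p t')) ∧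
    F (nextPosition p t))

variable (S X) in
/-- The condition for `p` to be losing, in terms of the set `F` of losing positions. -/
def LosesNow (F : Position d n → Prop) (p : Position d n) : Prop :=
  p.2.2.2.1 ∉ X ∧
  (∀ k ∈ p.2.2.1, ¬ leAt p.1 k p.2.2.2 ∨ ¬ (pumped p.1 k p.2.2.2).Nonempty ∨
    F (dropPosition p k)) ∧
  ((∃ k ∈ p.2.2.1, leAt p.1 k p.2.2.2) ∨ ∀ t ∈ S.enabledAt p.1 p.2.2.2,
    (p.2.2.2.1 ∉ S.Q₁ ∧ ∃ t' ∈ S.enabledAt p.1 p.2.2.2,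
      (¬ ∃ h ∈ p.2.1, leAt p.1 h (fireAt p.1 t' p.2.2.2)) ∧ F (newPosition p t')) ∨
    F (nextPosition p t))

theorem wins_iff (p : Position d n) : Wins S X p ↔ WinsNow S X (Wins S X) p := by
  constructor
  · obtain ⟨I, H, P, c⟩ := p
    intro hw
    cases hw with
    | target hX => exact .inl hX
    | pump hk hle hne hw => exact .inr (.inl ⟨_, hk, hle, hne, hw⟩)
    | step hrep ht hnew hw =>
      refine .inr (.inr ⟨fun ⟨k, hk, hle⟩ => hrep k hk hle, _, ht, ?_, hw⟩)
      by_cases h₁ : c.1 ∈ S.Q₁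
      · exact .inl h₁
      · refine .inr fun t' ht' => or_iff_not_imp_left.2 fun hcov => ?_
        exact hnew h₁ t' ht' fun h hh hle => hcov ⟨h, hh, hle⟩
  · rintro (hX | ⟨k, hk, hle, hne, hw⟩ | ⟨hrep, t, ht, hnew, hw⟩)
    · exact .target hX
    · exact .pump hk hle hne hw
    · refine .step (fun k hk hle => hrep ⟨k, hk, hle⟩) ht (fun h₁ t' ht' hcov => ?_) hw
      exact ((hnew.resolve_left h₁) t' ht').resolve_left fun ⟨h, hh, hle⟩ => hcov h hh hle

theorem not_winsNow_iff (F : Position d n → Prop) (p : Position d n) :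
    ¬ WinsNow S X F p ↔ LosesNow S X (fun q => ¬ F q) p := by
  simp only [WinsNow, LosesNow, not_or, not_exists, not_and]
  grind

theorem WinsNow.mono {F G : Position d n → Prop} {p : Position d n} (h : WinsNow S X F p)
    (hFG : ∀ q, Move S p q → F q → G q) : WinsNow S X G p := by
  rcases h with hX | ⟨k, hk, hle, hne, hF⟩ | ⟨hrep, t, ht, hnew, hF⟩
  · exact .inl hX
  · exact .inr (.inl ⟨k, hk, hle, hne, hFG _ (.drop hk hle hne) hF⟩)
  · refine .inr (.inr ⟨hrep, t, ht, hnew.imp_right fun hnew t' ht' => ?_, hFG _ (.next ht hrep) hF⟩)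
    by_cases hcov : ∃ h ∈ p.2.1, leAt p.1 h (fireAt p.1 t' p.2.2.2)
    · exact .inl hcov
    · exact .inr (hFG _ (.new ht' hcov) ((hnew t' ht').resolve_left hcov))

/-- Obtained from `WinsNow.mono` by the duality `not_winsNow_iff`. -/
theorem LosesNow.mono {F G : Position d n → Prop} {p : Position d n} (h : LosesNow S X F p)
    (hFG : ∀ q, Move S p q → F q → G q) : LosesNow S X G p := by
  have h' := (not_winsNow_iff (fun q => ¬ F q) p).2 (by simpa only [not_not] using h)
  have := (not_winsNow_iff (fun q => ¬ G q) p).1 fun hw => h' (hw.mono fun q hq => mt (hFG q hq))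
  simpa only [not_not] using this

/-! ### Encoding -/

namespace Code

/-- The code of a configuration. -/
def encConfig (c : Config d n) : Conf := (c.1, List.ofFn c.2)

/-- The code of a set of unbounded counters. -/
def encFrozen (I : Finset (Fin d)) : List Bool :=
  (List.range d).map fun i => decide (∃ h : i < d, (⟨i, h⟩ : Fin d) ∈ I)

/-- The code of a transition, without its weight. -/
def encTriple (t : Fin n × (Fin d → ℤ) × Fin n) : ℕ × List ℤ × ℕ :=
  (t.1, List.ofFn t.2.1, t.2.2)

/-- The code of a position. -/
def encPosition (p : Position d n) : Pos :=
  (encFrozen p.1, p.2.1.map encConfig, p.2.2.1.map encConfig, encConfig p.2.2.2)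

variable {k c : Config d n} {t : Fin n × (Fin d → ℤ) × Fin n} {m : ℕ}

theorem bit_encFrozen (i : Fin d) : bit (encFrozen I) i = decide (i ∈ I) := by
  simp [bit, encFrozen, List.getD_eq_getElem?_getD]

theorem counter_encConfig (i : Fin d) : counter (encConfig c) i = c.2 i := by
  simp [counter, encConfig, List.getD_eq_getElem?_getD]

theorem effect_encTriple (i : Fin d) : effect (encTriple t, m) i = t.2.1 i := by
  simp [effect, encTriple, List.getD_eq_getElem?_getD]

theorem forall_lt_iff {p : ℕ → Prop} : (∀ i < d, p i) ↔ ∀ i : Fin d, p i :=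
  ⟨fun h i => h i i.2, fun h i hi => h ⟨i, hi⟩⟩

theorem exists_lt_iff {p : ℕ → Prop} : (∃ i < d, p i) ↔ ∃ i : Fin d, p i :=
  ⟨fun ⟨i, hi, h⟩ => ⟨⟨i, hi⟩, h⟩, fun ⟨i, h⟩ => ⟨i, i.2, h⟩⟩

theorem exists_mem_map_iff {α β : Type*} {f : α → β} {l : List α} {p : β → Prop} :
    (∃ b ∈ l.map f, p b) ↔ ∃ a ∈ l, p (f a) := by
  simp

theorem leAt_enc : LeAt d (encFrozen I) (encConfig k) (encConfig c) ↔ leAt I k c := by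
  simp only [LeAt, leAt, forall_lt_iff, bit_encFrozen, counter_encConfig, decide_eq_true_eq,
    or_iff_not_imp_left]
  simp [encConfig, Fin.ext_iff]

theorem pumps_enc : Pumps d (encFrozen I) (encConfig k) (encConfig c) ↔
    (pumped I k c).Nonempty := by
  simp only [Pumps, exists_lt_iff, bit_encFrozen, counter_encConfig, decide_eq_false_iff_not,
    Finset.Nonempty, mem_pumped]

theorem enabled_enc (ht : t ∈ S.T) : Enabled d (encFrozen I) (encTriple t, m) (encConfig c) ↔
    t ∈ S.enabledAt I c := by
  simp only [Enabled, mem_enabledAt, forall_lt_iff, bit_encFrozen, counter_encConfig,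
    effect_encTriple, decide_eq_true_eq, or_iff_not_imp_left, ht, true_and]
  refine and_congr (by simp [encConfig, encTriple, Fin.ext_iff])
    (forall₂_congr fun i _ => ⟨fun h => ?_, fun h => ?_⟩) <;> omega

theorem map_range_eq {β : Type*} {f : ℕ → β} {g : Fin d → β} (h : ∀ i : Fin d, f i = g i) :
    (List.range d).map f = List.ofFn g := by
  refine List.ext_getElem (by simp) fun i h₁ h₂ => ?_
  simp only [List.getElem_map, List.getElem_range, List.getElem_ofFn]
  exact h ⟨i, by simpa using h₁⟩

theorem fire_enc (ht : t ∈ S.enabledAt I c) :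
    fire d (encFrozen I) (encTriple t, m) (encConfig c) = encConfig (fireAt I t c) := by
  refine Prod.ext rfl (map_range_eq fun i => ?_)
  simp only [bit_encFrozen, counter_encConfig, effect_encTriple, decide_eq_true_eq, fireAt]
  split_ifs with hi
  · rfl
  · have := (mem_enabledAt.1 ht).2.2 i hi
    omega

theorem release_enc : release d (encFrozen I) (encConfig k) (encConfig c) =
    encFrozen (I ∪ pumped I k c) := by
  refine List.map_congr_left fun i hi => ?_
  have hi' := List.mem_range.1 hi
  have h1 := bit_encFrozen (I := I) ⟨i, hi'⟩
  have h2 := counter_encConfig (c := c) ⟨i, hi'⟩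
  have h3 := counter_encConfig (c := k) ⟨i, hi'⟩
  simp only at h1 h2 h3
  rw [h1, h2, h3, Bool.eq_iff_iff]
  simp only [Bool.or_eq_true, decide_eq_true_eq, Finset.mem_union, mem_pumped, hi', exists_true_left]
  tauto

theorem dropPos_enc (p : Position d n) (k : Config d n) :
    dropPos d (encPosition p) (encConfig k) = encPosition (dropPosition p k) := by
  simp only [dropPos, encPosition, dropPosition, release_enc, List.map_cons, List.map_nil]

theorem newPos_enc (p : Position d n) (ht : t ∈ S.enabledAt p.1 p.2.2.2) :
    newPos d (encPosition p) (encTriple t, m) = encPosition (newPosition p t) := by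
  simp only [newPos, encPosition, newPosition, fire_enc ht, List.map_cons, List.map_nil]

theorem nextPos_enc (p : Position d n) (ht : t ∈ S.enabledAt p.1 p.2.2.2) :
    nextPos d (encPosition p) (encTriple t, m) = encPosition (nextPosition p t) := by
  simp only [nextPos, encPosition, nextPosition, fire_enc ht, List.map_cons]

theorem covered_enc (p : Position d n) (ht : t ∈ S.enabledAt p.1 p.2.2.2) :
    Covered d (encPosition p) (encTriple t, m) ↔
      ∃ h ∈ p.2.1, leAt p.1 h (fireAt p.1 t p.2.2.2) := by
  simp only [Covered, encPosition, fire_enc ht, exists_mem_map_iff, leAt_enc]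

theorem repeats_enc (p : Position d n) :
    Repeats d (encPosition p) ↔ ∃ k ∈ p.2.2.1, leAt p.1 k p.2.2.2 := by
  simp only [Repeats, encPosition, exists_mem_map_iff, leAt_enc]

section Encodes

variable {w : Code} {c₀ : Config d n} {L : List (Pos × Bool)}

theorem fst_of_encodes (h : Encodes w S c₀ X) : w.1 = d := by
  obtain ⟨l, -, -, rfl⟩ := h
  rfl

theorem initPos_of_encodes (h : Encodes w S c₀ X) : initPos w = encPosition (∅, [c₀], [], c₀) := by
  obtain ⟨l, -, -, rfl⟩ := h
  simp [initPos, encPosition, encFrozen, encConfig]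

theorem target_enc (h : Encodes w S c₀ X) (c : Config d n) : Target w (encConfig c) ↔ c.1 ∈ X := by
  obtain ⟨l, -, -, rfl⟩ := h
  simp [Target, encConfig, List.getD_eq_getElem?_getD]

theorem player_enc (h : Encodes w S c₀ X) (c : Config d n) :
    Player w (encConfig c) ↔ c.1 ∈ S.Q₁ := by
  obtain ⟨l, -, -, rfl⟩ := h
  simp [Player, encConfig, List.getD_eq_getElem?_getD]

theorem exists_enabled_enc (h : Encodes w S c₀ X) {φ : Trans → Prop} :
    (∃ t ∈ w.2.2.1, Enabled d (encFrozen I) t (encConfig c) ∧ φ t) ↔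
      ∃ t ∈ S.enabledAt I c, φ (encTriple t, S.τ t) := by
  obtain ⟨l, -, hl, rfl⟩ := h
  rw [exists_mem_map_iff]
  constructor
  · rintro ⟨t, ht, hen, hφ⟩
    exact ⟨t, (enabled_enc (hl ▸ List.mem_toFinset.2 ht)).1 hen, hφ⟩
  · rintro ⟨t, ht, hφ⟩
    have hT := (mem_enabledAt.1 ht).1
    exact ⟨t, List.mem_toFinset.1 (hl ▸ hT), (enabled_enc hT).2 ht, hφ⟩

theorem forall_enabled_enc (h : Encodes w S c₀ X) {φ : Trans → Prop} :
    (∀ t ∈ w.2.2.1, ¬ Enabled d (encFrozen I) t (encConfig c) ∨ φ t) ↔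
      ∀ t ∈ S.enabledAt I c, φ (encTriple t, S.τ t) := by
  have := (exists_enabled_enc h (I := I) (c := c) (φ := fun t => ¬ φ t)).not
  push Not at this
  simpa only [← not_or, or_iff_not_imp_left, not_not] using this

theorem localWin_enc (h : Encodes w S c₀ X) (p : Position d n) :
    LocalWin w L (encPosition p) ↔ WinsNow S X (fun q => (encPosition q, true) ∈ L) p := by
  rw [LocalWin, WinsNow, fst_of_encodes h, repeats_enc]
  refine or_congr (target_enc h _) (or_congr ?_ (and_congr_right fun _ => ?_))
  · refine (exists_mem_map_iff (f := encConfig)).trans ?_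
    simp only [dropPos_enc]
    exact exists_congr fun k => and_congr_right fun _ =>
      and_congr leAt_enc (and_congr_left fun _ => pumps_enc)
  · refine (exists_enabled_enc h (I := p.1) (c := p.2.2.2)).trans
      (exists_congr fun t => and_congr_right fun ht => ?_)
    rw [nextPos_enc p ht]
    refine and_congr_left fun _ => or_congr (player_enc h _)
      ((forall_enabled_enc h (I := p.1) (c := p.2.2.2)).trans (forall₂_congr fun t' ht' => ?_))
    rw [covered_enc p ht', newPos_enc p ht']

theorem localLose_enc (h : Encodes w S c₀ X) (p : Position d n) :
    LocalLose w L (encPosition p) ↔ LosesNow S X (fun q => (encPosition q, false) ∈ L) p := by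
  rw [LocalLose, LosesNow, fst_of_encodes h, repeats_enc]
  refine and_congr (target_enc h _).not (and_congr ?_ (or_congr_right ?_))
  · refine (List.forall_mem_map (f := encConfig)).trans ?_
    simp only [dropPos_enc]
    exact forall₂_congr fun k _ => or_congr leAt_enc.not (or_congr_left pumps_enc.not)
  · refine (forall_enabled_enc h (I := p.1) (c := p.2.2.2)).trans
      (forall₂_congr fun t ht => ?_)
    rw [nextPos_enc p ht]
    refine or_congr_left (and_congr (player_enc h _).not
      ((exists_enabled_enc h (I := p.1) (c := p.2.2.2)).trans
        (exists_congr fun t' => and_congr_right fun ht' => ?_)))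
    rw [covered_enc p ht', newPos_enc p ht']

/-- Valid labels are correct. -/
theorem Valid.label_iff (h : Encodes w S c₀ X) (hL : Valid w L) (p : Position d n) {b : Bool}
    (hp : (encPosition p, b) ∈ L) : b = true ↔ Wins S X p := by
  -- Well-foundedness excludes labels that justify one another in a circle. Codes are only compared
  -- for membership in `L`, so injectivity of `encPosition` is not needed.
  induction p using move_induction (S := S) generalizing b with
  | h p ih =>
    rcases hL _ hp with ⟨rfl, hloc⟩ | ⟨rfl, hloc⟩
    · refine iff_of_true rfl ((wins_iff p).2 ?_)
      exact ((localWin_enc h p).1 hloc).mono fun q hq hF => (ih q hq hF).1 rfl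
    · refine iff_of_false Bool.false_ne_true ?_
      rw [wins_iff, not_winsNow_iff]
      exact ((localLose_enc h p).1 hloc).mono fun q hq hF =>
        mt (ih q hq hF).2 Bool.false_ne_true

theorem LocalWin.mono {L' : List (Pos × Bool)} {p : Pos} (h : LocalWin w L p) (hL : L ⊆ L') :
    LocalWin w L' p := by
  rcases h with hX | ⟨k, hk, hle, hne, hF⟩ | ⟨hrep, t, ht, hen, hnew, hF⟩
  · exact .inl hX
  · exact .inr (.inl ⟨k, hk, hle, hne, hL hF⟩)
  · exact .inr (.inr ⟨hrep, t, ht, hen, hnew.imp_right fun hnew t' ht' =>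
      (hnew t' ht').imp_right (Or.imp_right fun h => hL h), hL hF⟩)

theorem LocalLose.mono {L' : List (Pos × Bool)} {p : Pos} (h : LocalLose w L p) (hL : L ⊆ L') :
    LocalLose w L' p := by
  refine ⟨h.1, fun k hk => (h.2.1 k hk).imp_right (Or.imp_right fun h => hL h),
    h.2.2.imp_right fun h t ht => (h t ht).imp_right (Or.imp ?_ fun h => hL h)⟩
  rintro ⟨h₁, t', ht', hen, hcov, hF⟩
  exact ⟨h₁, t', ht', hen, hcov, hL hF⟩

theorem Valid.local_of_subset {L' : List (Pos × Bool)} (h : Valid w L) (hL : L ⊆ L')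
    {x : Pos × Bool} (hx : x ∈ L) :
    (x.2 = true ∧ LocalWin w L' x.1) ∨ (x.2 = false ∧ LocalLose w L' x.1) :=
  (h x hx).imp (And.imp_right fun h => h.mono hL) (And.imp_right fun h => h.mono hL)

theorem Valid.append {L' : List (Pos × Bool)} (h : Valid w L) (h' : Valid w L') :
    Valid w (L ++ L') := by
  intro x hx
  rcases List.mem_append.1 hx with hx | hx
  exacts [h.local_of_subset (List.subset_append_left _ _) hx,
    h'.local_of_subset (List.subset_append_right _ _) hx]

theorem Valid.cons {x : Pos × Bool} (h : Valid w L)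
    (hx : (x.2 = true ∧ LocalWin w L x.1) ∨ (x.2 = false ∧ LocalLose w L x.1)) :
    Valid w (x :: L) := by
  have hsub : L ⊆ x :: L := List.subset_cons_self _ _
  intro y hy
  rcases List.mem_cons.1 hy with rfl | hy
  · exact hx.imp (And.imp_right fun h => h.mono hsub) (And.imp_right fun h => h.mono hsub)
  · exact h.local_of_subset hsub hy

/-- Every position is labelled in some valid list. -/
theorem exists_valid (h : Encodes w S c₀ X) (p : Position d n) :
    ∃ L, Valid w L ∧ ∃ b, (encPosition p, b) ∈ L := by
  induction p using move_induction (S := S) with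
  | h p ih =>
    -- Valid lists for the finitely many successors are concatenated; validity survives because
    -- local justifications are monotone in the list.
    have key : ∀ l : List (Position d n), (∀ q ∈ l, Move S p q) →
        ∃ L, Valid w L ∧ ∀ q ∈ l, ∃ b, (encPosition q, b) ∈ L := by
      intro l
      induction l with
      | nil => exact fun _ => ⟨[], by simp [Valid], by simp⟩
      | cons q l ihl =>
        intro hl
        obtain ⟨L, hL, hlab⟩ := ihl fun q hq => hl q (List.mem_cons_of_mem _ hq)
        obtain ⟨L', hL', b, hb⟩ := ih q (hl q List.mem_cons_self)
        refine ⟨L' ++ L, hL'.append hL, fun q' hq' => ?_⟩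
        rcases List.mem_cons.1 hq' with rfl | hq'
        · exact ⟨b, List.mem_append_left _ hb⟩
        · exact (hlab q' hq').imp fun b hb => List.mem_append_right _ hb
    obtain ⟨L, hL, hlab⟩ := key (finite_moves (S := S) p).toFinset.toList (by simp)
    have hlab' : ∀ q, Move S p q → ∃ b, (encPosition q, b) ∈ L := fun q hq => hlab q (by simpa)
    by_cases hw : Wins S X p
    · refine ⟨(encPosition p, true) :: L, hL.cons (.inl ⟨rfl, (localWin_enc h p).2 ?_⟩), true,
        List.mem_cons_self⟩
      refine ((wins_iff p).1 hw).mono fun q hq hF => ?_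
      obtain ⟨b, hb⟩ := hlab' q hq
      obtain rfl := (hL.label_iff h q hb).2 hF
      exact hb
    · refine ⟨(encPosition p, false) :: L, hL.cons (.inr ⟨rfl, (localLose_enc h p).2 ?_⟩), false,
        List.mem_cons_self⟩
      rw [wins_iff, not_winsNow_iff] at hw
      refine hw.mono fun q hq hF => ?_
      obtain ⟨b, hb⟩ := hlab' q hq
      cases b with
      | true => exact absurd ((hL.label_iff h q hb).1 rfl) hF
      | false => exact hb

/-- A label of the initial position in a valid list decides limit-sure reachability. -/
theorem Valid.label_initPos_iff (h : Encodes w S c₀ X) (hS : S.IsOneVASSMDP) (hL : Valid w L)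
    {b : Bool} (hb : (initPos w, b) ∈ L) : b = true ↔ S.LimitSureReach c₀ X := by
  rw [initPos_of_encodes h] at hb
  exact (hL.label_iff h _ hb).trans (limitSureReach_iff_win hS).symm

end Encodes

/-! ### Well-formed codes -/

theorem encTriple_injective :
    Function.Injective (encTriple : Fin n × (Fin d → ℤ) × Fin n → ℕ × List ℤ × ℕ) := by
  rintro ⟨x, z, y⟩ ⟨x', z', y'⟩ h
  simp only [encTriple, Prod.mk.injEq, Fin.val_inj] at h
  obtain ⟨rfl, h, rfl⟩ := h
  rw [List.ofFn_injective h]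

theorem forall_getElem?_ne_iff_nodup {α : Type*} {l : List α} :
    (∀ j < l.length, ∀ i < j, l[i]? ≠ l[j]?) ↔ l.Nodup := by
  rw [List.nodup_iff_getElem?_ne_getElem?]
  exact ⟨fun h i j hij hj => h j hj i hij, fun h j hj i hij => h i j hij hj⟩

theorem wellFormed_of_encodes {w : Code} {c₀ : Config d n} (h : Encodes w S c₀ X)
    (hS : S.IsOneVASSMDP) : WellFormed w := by
  obtain ⟨l, hnd, hl, rfl⟩ := h
  refine ⟨?_, ?_, by simp, by simp, by simp⟩
  · intro r hr
    obtain ⟨t, ht, rfl⟩ := List.mem_map.1 hr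
    have hT : t ∈ S.T := hl ▸ List.mem_toFinset.2 ht
    refine ⟨by simp, by simp, (S.τ_pos_iff t).2 hT, ?_⟩
    by_cases h₁ : t.1 ∈ S.Q₁
    · exact .inl (by simpa [List.getD_eq_getElem?_getD] using h₁)
    · exact .inr (forall_lt_iff.2 fun i =>
        (effect_encTriple (m := S.τ t) i).trans (congrFun (hS t hT h₁) i))
  · have := (forall_getElem?_ne_iff_nodup (l := l.map encTriple)).2
      (hnd.map encTriple_injective)
    rw [List.length_map] at this
    simp only [List.length_map, List.map_map]
    exact this

theorem eq_ofFn {β : Type*} {l : List β} {m : ℕ} (h : l.length = m) (a : β) :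
    l = List.ofFn fun i : Fin m => l.getD i a := by
  subst h
  refine List.ext_getElem (by simp) fun i _ _ => ?_
  simp [List.getD_eq_getElem?_getD]

theorem exists_encodes_of_wellFormed {w : Code} (h : WellFormed w) :
    ∃ (d n : ℕ) (S : VASSMDP d n) (c₀ : Config d n) (X : Finset (Fin n)),
      Encodes w S c₀ X ∧ S.IsOneVASSMDP := by
  classical
  obtain ⟨d, qs, ts, ⟨q₀, v₀⟩, xs⟩ := w
  obtain ⟨hts, hnd, hq₀, hv₀, hxs⟩ := h
  simp only at hts hnd hq₀ hv₀ hxs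
  rw [← List.length_map (f := fun t : Trans => t.1), forall_getElem?_ne_iff_nodup] at hnd
  set n := qs.length with hn
  -- The weight is the listed one, unique since triples do not repeat. The default `0` makes `τ`
  -- vanish off the list, as `τ_pos_iff` demands.
  let τ : Fin n × (Fin d → ℤ) × Fin n → ℕ := fun t =>
    if h : ∃ m, (encTriple t, m) ∈ ts then h.choose else 0
  have hτ : ∀ t m, (encTriple t, m) ∈ ts → τ t = m := by
    intro t m htm
    have hex : ∃ m, (encTriple t, m) ∈ ts := ⟨m, htm⟩
    have : (encTriple t, hex.choose) = (encTriple t, m) :=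
      List.inj_on_of_nodup_map hnd hex.choose_spec htm rfl
    simp only [τ, hex, dif_pos]
    exact congrArg Prod.snd this
  obtain ⟨l, hl⟩ : ∃ l : List (Fin n × (Fin d → ℤ) × Fin n),
      l.map (fun t => (encTriple t, τ t)) = ts := by
    rw [← Set.mem_range, Set.range_list_map]
    rintro ⟨⟨x, z, y⟩, m⟩ ht
    obtain ⟨⟨hx, hy⟩, hz, -, -⟩ := hts _ ht
    have henc : encTriple ((⟨x, hx⟩, fun i => z.getD i 0, ⟨y, hy⟩) :
        Fin n × (Fin d → ℤ) × Fin n) = (x, z, y) := by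
      simp only [encTriple]
      rw [← eq_ofFn hz]
    exact ⟨_, Prod.ext henc (hτ _ m (henc ▸ ht))⟩
  have hmem : ∀ t, t ∈ l → (encTriple t, τ t) ∈ ts := fun t ht => hl ▸ List.mem_map_of_mem ht
  have hlnd : l.Nodup := by
    rw [← hl, List.map_map] at hnd
    exact hnd.of_map _
  let S : VASSMDP d n :=
    { Q₁ := Finset.univ.filter fun q => qs.getD q false = true
      T := l.toFinset
      τ := τ
      τ_pos_iff := fun t => by
        rw [List.mem_toFinset]
        constructor
        · intro hpos
          by_cases hex : ∃ m, (encTriple t, m) ∈ ts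
          · obtain ⟨m, hm⟩ := hex
            rw [← hl] at hm
            obtain ⟨t', ht', heq⟩ := List.mem_map.1 hm
            rwa [← encTriple_injective (congrArg Prod.fst heq)]
          · simp [τ, hex] at hpos
        · exact fun ht => (hts _ (hmem t ht)).2.2.1 }
  refine ⟨d, n, S, (⟨q₀, hq₀⟩, fun i => v₀.getD i 0),
    Finset.univ.filter fun q => xs.getD q false = true, ⟨l, hlnd, rfl, ?_⟩, ?_⟩
  · refine Prod.ext rfl (Prod.ext ?_ (Prod.ext hl.symm (Prod.ext (Prod.ext rfl ?_) ?_)))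
    · simpa [S] using eq_ofFn hn.symm false
    · exact eq_ofFn hv₀ 0
    · simpa using eq_ofFn hxs false
  · intro t ht h₁
    have ht' := hts _ (hmem t (List.mem_toFinset.1 ht))
    have hz := ht'.2.2.2.resolve_left fun h => h₁ (Finset.mem_filter.2 ⟨Finset.mem_univ _, h⟩)
    funext i
    rw [← effect_encTriple (t := t) (m := τ t)]
    exact hz i i.2

end Code

end VASSMDP

end

/-! ### Decidability by searching for certificates -/

theorem mainTheorem1 :
    ComputablePred fun w : VASSMDP.Code =>
      ∃ (d n : ℕ) (S : VASSMDP d n) (c₀ : VASSMDP.Config d n) (X : Finset (Fin n)),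
        VASSMDP.Encodes w S c₀ X ∧ S.IsOneVASSMDP ∧ S.LimitSureReach c₀ X := by
  open VASSMDP VASSMDP.Code in
  have hinit : Primrec fun x : VASSMDP.Code × List (Pos × Bool) => initPos x.1 :=
    primrec_initPos Primrec.fst
  have hvalid : PrimrecPred fun x : VASSMDP.Code × List (Pos × Bool) => Valid x.1 x.2 :=
    primrecPred_valid Primrec.fst Primrec.snd
  have hwf : PrimrecPred fun x : VASSMDP.Code × List (Pos × Bool) => WellFormed x.1 :=
    primrecPred_wellFormed Primrec.fst
  refine ComputablePred.computable_iff_re_compl_re'.2 ⟨?_, ?_⟩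
  · refine (PrimrecPred.rePred_exists (p := fun w L => WellFormed w ∧ Valid w L ∧
      (initPos w, true) ∈ L) (hwf.and (hvalid.and
        (primrecPred_mem_label hinit Primrec.snd true)))).of_eq fun w => ⟨?_, ?_⟩
    · rintro ⟨L, hw, hL, hp⟩
      obtain ⟨d, n, S, c₀, X, henc, hS⟩ := exists_encodes_of_wellFormed hw
      exact ⟨d, n, S, c₀, X, henc, hS, (hL.label_initPos_iff henc hS hp).1 rfl⟩
    · rintro ⟨d, n, S, c₀, X, henc, hS, hlim⟩
      obtain ⟨L, hL, b, hb⟩ := exists_valid henc (∅, [c₀], [], c₀)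
      rw [← initPos_of_encodes henc] at hb
      obtain rfl := (hL.label_initPos_iff henc hS hb).2 hlim
      exact ⟨L, wellFormed_of_encodes henc hS, hL, hb⟩
  -- The complement also contains the codes that describe no 1-VASS-MDP; these are accepted with any
  -- list.
  · refine (PrimrecPred.rePred_exists (p := fun w L => ¬ WellFormed w ∨ (Valid w L ∧
      (initPos w, false) ∈ L)) (hwf.not.or (hvalid.and
        (primrecPred_mem_label hinit Primrec.snd false)))).of_eq fun w => ⟨?_, ?_⟩
    · rintro ⟨L, hL⟩ ⟨d, n, S, c₀, X, henc, hS, hlim⟩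
      obtain ⟨hL, hb⟩ := hL.resolve_left fun h => h (wellFormed_of_encodes henc hS)
      exact Bool.false_ne_true ((hL.label_initPos_iff henc hS hb).2 hlim)
    · intro hno
      by_cases hw : WellFormed w
      · obtain ⟨d, n, S, c₀, X, henc, hS⟩ := exists_encodes_of_wellFormed hw
        obtain ⟨L, hL, b, hb⟩ := exists_valid henc (∅, [c₀], [], c₀)
        rw [← initPos_of_encodes henc] at hb
        cases b with
        | true => exact absurd ⟨d, n, S, c₀, X, henc, hS, (hL.label_initPos_iff henc hS hb).1 rfl⟩ hno
        | false => exact ⟨L, .inr ⟨hL, hb⟩⟩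
      · exact ⟨[], .inl hw⟩
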